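/- Let $E$ and $M$ be (finite-dimensional, Hausdorff) real-analytic manifolds, let $\pi:E\to M$ be a real-analytic submersion and let $\mathcal D\subset TE$ be a real-analytic distribution (that is, a real-analytic vector subbundle of $TE$) which is horizontal with respect to $\pi$: $T_xE=\mathrm{Ker}(\mathrm d\pi_x)\oplus\mathcal D_x$ for all $x\in E$. A horizontal lifting of a curve $\gamma:I\to M$ is a piecewise smooth curve $\tilde\gamma:I\to E$ such that $\pi\circ\tilde\gamma=\gamma$ and $\tilde\gamma'(t)\in\mathcal D_{\tilde\gamma(t)}$ for every $t\in I$ at which $\tilde\gamma'(t)$ exists. A (local) horizontal section of $\pi$ on an open set $U\subset M$ is a smooth map $s:U\to E$ such that $\pi\circ s=\mathrm{Id}_U$ and the range of $\mathrm ds_m$ is $\mathcal D_{s(m)}$ for all $m\in U$; it is called global if $U=M$. Assume that: (a) $M$ is connected and simply connected; (b) for every real-analytic curve $\gamma:I\to M$ defined on an open interval $I\subset\mathbb R$, every $t_0\in I$ and every $e_0\in\pi^{-1}(\gamma(t_0))$, there exists a horizontal lifting $\tilde\gamma:I\to E$ of $\gamma$, defined on all of $I$, with $\tilde\gamma(t_0)=e_0$.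 Then every local horizontal section $s:U\to E$ of $\pi$ defined on a nonempty connected open subset $U$ of $M$ extends to a global horizontal section of $\pi$. In particular, let $\Gamma^\infty(\mathcal D)$ be the Lie subalgebra of the Lie algebra of smooth vector fields on $E$ generated by the smooth vector fields on $E$ with values in $\mathcal D$. If there is a point $e_0\in E$ such that $X(e_0)\in\mathcal D_{e_0}$ for all $X\in\Gamma^\infty(\mathcal D)$, then $\pi$ admits a global horizontal section. -/

import Mathlib

open Set Manifold
open scoped ContDiff Topology

/-- A real-analytic distribution on a real-analytic manifold `E` modelled on `V`: a real-analytic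
vector subbundle of `TE`, i.e. a family of subspaces `D x ⊆ T_x E` which near every point is spanned
by a linearly independent system of real-analytic vector fields. -/
def IsAnalyticDistribution {V : Type*} [NormedAddCommGroup V] [NormedSpace ℝ V]
    {E : Type*} [TopologicalSpace E] [ChartedSpace V E] [IsManifold 𝓘(ℝ, V) ω E]
    (D : ∀ x : E, Submodule ℝ (TangentSpace 𝓘(ℝ, V) x)) : Prop :=
  ∀ x₀ : E, ∃ U : Set E, IsOpen U ∧ x₀ ∈ U ∧
    ∃ (k : ℕ) (X : Fin k → ∀ x : E, TangentSpace 𝓘(ℝ, V) x),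
      (∀ i, ContMDiffOn 𝓘(ℝ, V) 𝓘(ℝ, V).tangent ω
        (fun x ↦ (⟨x, X i x⟩ : TangentBundle 𝓘(ℝ, V) E)) U) ∧
      ∀ x ∈ U, LinearIndependent ℝ (fun i ↦ X i x) ∧
        Submodule.span ℝ (Set.range fun i ↦ X i x) = D x

/-- A distribution `D` on `E` is horizontal with respect to `π : E → M` if
`T_x E = ker (dπ_x) ⊕ D x` for every `x`. -/
def IsHorizontalDistribution {V W : Type*} [NormedAddCommGroup V] [NormedSpace ℝ V]
    [NormedAddCommGroup W] [NormedSpace ℝ W]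
    {E : Type*} [TopologicalSpace E] [ChartedSpace V E]
    {M : Type*} [TopologicalSpace M] [ChartedSpace W M]
    (π : E → M) (D : ∀ x : E, Submodule ℝ (TangentSpace 𝓘(ℝ, V) x)) : Prop :=
  ∀ x : E, IsCompl (mfderiv 𝓘(ℝ, V) 𝓘(ℝ, W) π x).ker (D x)

/-- Piecewise smooth curves on an interval `J`: `c` is continuous on `J`, and every compact
subinterval `[a, b]` of `J` has a finite set `P` of break points such that `c` is smooth (up to
the end points) on each closed subinterval whose interior contains no break point. -/
def IsPiecewiseSmoothOn {V : Type*} [NormedAddCommGroup V] [NormedSpace ℝ V]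
    {E : Type*} [TopologicalSpace E] [ChartedSpace V E] (c : ℝ → E) (J : Set ℝ) : Prop :=
  ContinuousOn c J ∧
    ∀ a b : ℝ, Icc a b ⊆ J → ∃ P : Finset ℝ,
      ∀ p q : ℝ, Icc p q ⊆ Icc a b → Disjoint (Ioo p q) (P : Set ℝ) →
        ContMDiffOn 𝓘(ℝ, ℝ) 𝓘(ℝ, V) ∞ c (Icc p q)

/-- `c` is, on the open interval `J`, a horizontal lifting of `γ`: it is piecewise smooth,
`π ∘ c = γ` on `J`, and `c'(t) ∈ D (c t)` for all `t ∈ J` at which `c'(t)` exists. -/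
structure IsHorizontalLift {V : Type*} [NormedAddCommGroup V] [NormedSpace ℝ V]
    {E : Type*} [TopologicalSpace E] [ChartedSpace V E] {M : Type*}
    (π : E → M) (D : ∀ x : E, Submodule ℝ (TangentSpace 𝓘(ℝ, V) x))
    (γ : ℝ → M) (J : Set ℝ) (c : ℝ → E) : Prop where
  piecewiseSmooth : IsPiecewiseSmoothOn (V := V) c J
  lifts : ∀ t ∈ J, π (c t) = γ t
  horizontal : ∀ t ∈ J, MDifferentiableAt 𝓘(ℝ, ℝ) 𝓘(ℝ, V) c t →
    mfderiv 𝓘(ℝ, ℝ) 𝓘(ℝ, V) c t (1 : ℝ) ∈ D (c t)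

/-- `s` is, on the open set `U ⊆ M`, a (smooth) horizontal section of `π : E → M`: it is smooth on
`U`, `π ∘ s = id` on `U`, and the range of `ds_m` is `D (s m)` for all `m ∈ U`. The values of `s`
outside `U` play no role. -/
structure IsHorizontalSectionOn {V W : Type*} [NormedAddCommGroup V] [NormedSpace ℝ V]
    [NormedAddCommGroup W] [NormedSpace ℝ W]
    {E : Type*} [TopologicalSpace E] [ChartedSpace V E]
    {M : Type*} [TopologicalSpace M] [ChartedSpace W M]
    (π : E → M) (D : ∀ x : E, Submodule ℝ (TangentSpace 𝓘(ℝ, V) x))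
    (U : Set M) (s : M → E) : Prop where
  smooth : ContMDiffOn 𝓘(ℝ, W) 𝓘(ℝ, V) ∞ s U
  isSection : ∀ m ∈ U, π (s m) = m
  horizontal : ∀ m ∈ U, (mfderiv 𝓘(ℝ, W) 𝓘(ℝ, V) s m).range = D (s m)

/-- The Lie algebra `Γ^∞(D)`: the Lie subalgebra of the Lie algebra of smooth vector fields on `E`
generated by the smooth vector fields on `E` with values in `D`. -/
inductive MemGeneratedLieAlgebra {V : Type*} [NormedAddCommGroup V] [NormedSpace ℝ V]
    {E : Type*} [TopologicalSpace E] [ChartedSpace V E] [IsManifold 𝓘(ℝ, V) ω E]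
    (D : ∀ x : E, Submodule ℝ (TangentSpace 𝓘(ℝ, V) x)) :
    (∀ x : E, TangentSpace 𝓘(ℝ, V) x) → Prop
  | horizontal (X : ∀ x : E, TangentSpace 𝓘(ℝ, V) x)
      (smooth : ContMDiff 𝓘(ℝ, V) 𝓘(ℝ, V).tangent ∞
        (fun x ↦ (⟨x, X x⟩ : TangentBundle 𝓘(ℝ, V) E)))
      (mem : ∀ x, X x ∈ D x) : MemGeneratedLieAlgebra D X
  | add (X Y : ∀ x : E, TangentSpace 𝓘(ℝ, V) x) (hX : MemGeneratedLieAlgebra D X)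
      (hY : MemGeneratedLieAlgebra D Y) : MemGeneratedLieAlgebra D (fun x ↦ X x + Y x)
  | smul (a : ℝ) (X : ∀ x : E, TangentSpace 𝓘(ℝ, V) x) (hX : MemGeneratedLieAlgebra D X) :
      MemGeneratedLieAlgebra D (fun x ↦ a • X x)
  | bracket (X Y : ∀ x : E, TangentSpace 𝓘(ℝ, V) x) (hX : MemGeneratedLieAlgebra D X)
      (hY : MemGeneratedLieAlgebra D Y) :
      MemGeneratedLieAlgebra D (VectorField.mlieBracket 𝓘(ℝ, V) X Y)

/-!
In coordinates adapted to the submersion, the horizontal distribution is the graph of an analytic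
map `A : W × F → (W →L[ℝ] F)`, and horizontal sections are the solutions of the Pfaffian system
`dy = A (x, y) dx`. The *iterated curvatures* at a point are the vertical parts of the iterated
brackets `[X_v, [X_v, …, [X_v, X_w]…]]`, where `X_v` is the horizontal field over the constant field
`v`.

**A point lies on a horizontal section if and only if all iterated curvatures vanish there.**
They vanish along every section. Conversely, the function `η` that solves the system along the rays
through the base point is analytic (`exists_analytic_radial_solution`). The curvature along the lift
of a ray to the graph of `η` is then an analytic function of one variable. If the iterated
curvatures vanish at the base point, then this function vanishes there to infinite order, so that it
is zero. The defect `dη - A` therefore solves a homogeneous linear differential equation along each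
ray, and `η` solves the whole system (`exists_solution_of_iteratedCurvature_eq_zero`). Here
analyticity is essential. Two consequences follow. If all fields in the Lie algebra generated by
the horizontal fields are horizontal at `e₀`, then a section passes through `e₀`
(`AdaptedChart.iteratedCurvature_eq_zero_of_memGeneratedLieAlgebra`). And the set of points which
lie on a horizontal section is closed (`isClosed_setOf_hasHorizontalGerm`).

**Monodromy.** The set of these points, with the topology for which sections are open embeddings,
is the space `HorizontalGerms` of germs of horizontal sections; its projection to `M` is a separated
local homeomorphism. A horizontal lift of an analytic curve which starts in this set follows
sections as long as it stays in it, and never leaves it since the set is closed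
(`HorizontalGerms.exists_continuousOn_lift`). Lifting the segments of a coordinate ball gives
sections over the ball through each germ, so that the space of germs is a covering of `M`
(`HorizontalGerms.isCoveringMap_proj`). As `M` is simply connected, the covering has a global
section through each of its points (`HorizontalGerms.exists_global_section`).
-/

/-! ### Composition operators on spaces of continuous functions -/

section CompositionOperator

variable {K E G : Type*} [TopologicalSpace K] [CompactSpace K]
  [NormedAddCommGroup E] [NormedSpace ℝ E] [NormedAddCommGroup G] [NormedSpace ℝ G]

/-- A continuous multilinear map `q`, applied pointwise to continuous functions on `K`. -/
noncomputable def ContinuousMultilinearMap.pointwise (K : Type*) [TopologicalSpace K]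
    [CompactSpace K] {n : ℕ} (q : ContinuousMultilinearMap ℝ (fun _ : Fin n ↦ E) G) :
    ContinuousMultilinearMap ℝ (fun _ : Fin n ↦ C(K, E)) C(K, G) :=
  MultilinearMap.mkContinuous
    { toFun := fun h ↦ ⟨fun k ↦ q fun i ↦ h i k, by fun_prop⟩
      map_update_add' := by
        intro _ h i x y
        ext k
        have key (z : C(K, E)) : (fun j ↦ Function.update h i z j k)
            = Function.update (fun j ↦ h j k) i (z k) := by
          ext j; by_cases hj : j = i
          · subst hj; simp
          · simp [hj]
        simp only [ContinuousMap.coe_mk, ContinuousMap.add_apply, key]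
        exact q.map_update_add _ i (x k) (y k)
      map_update_smul' := by
        intro _ h i c x
        ext k
        have key (z : C(K, E)) : (fun j ↦ Function.update h i z j k)
            = Function.update (fun j ↦ h j k) i (z k) := by
          ext j; by_cases hj : j = i
          · subst hj; simp
          · simp [hj]
        simp only [ContinuousMap.coe_mk, ContinuousMap.smul_apply, key]
        exact q.map_update_smul _ i c (x k) }
    ‖q‖ (fun h ↦ by
      refine (ContinuousMap.norm_le _ (by positivity)).2 fun k ↦ ?_
      refine (q.le_opNorm _).trans ?_
      gcongr with i
      exact (h i).norm_coe_le_norm k)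

lemma ContinuousMultilinearMap.norm_pointwise_le {n : ℕ}
    (q : ContinuousMultilinearMap ℝ (fun _ : Fin n ↦ E) G) : ‖q.pointwise K‖ ≤ ‖q‖ :=
  MultilinearMap.mkContinuous_norm_le _ (norm_nonneg _) _

/-- The composition operator `u ↦ g ∘ u` on continuous functions on a compact space; its value at
`u` is `0` when `g ∘ u` is not continuous. -/
noncomputable def compOperator (K : Type*) [TopologicalSpace K] (g : E → G) (u : C(K, E)) :
    C(K, G) :=
  ContinuousMap.mkD (g ∘ u) 0

omit [CompactSpace K] [NormedSpace ℝ E] [NormedSpace ℝ G] in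
lemma compOperator_apply {g : E → G} {u : C(K, E)} (h : Continuous (g ∘ u)) (k : K) :
    compOperator K g u k = g (u k) := by
  rw [compOperator, ContinuousMap.mkD_apply_of_continuous h, Function.comp_apply]

/-- If `g` is analytic at `e₀`, then composition with `g` is analytic at the constant function `e₀`:
the terms of its power series are those of `g`, applied pointwise. -/
theorem analyticAt_compOperator [CompleteSpace G] {g : E → G} {e₀ : E} (hg : AnalyticAt ℝ g e₀) :
    AnalyticAt ℝ (compOperator K g) (ContinuousMap.const K e₀) := by
  obtain ⟨q, r, hq⟩ := hg
  let Q : FormalMultilinearSeries ℝ C(K, E) C(K, G) := fun n ↦ (q n).pointwise K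
  have hQ : q.radius ≤ Q.radius := by
    refine ENNReal.le_of_forall_nnreal_lt fun s hs ↦ ?_
    obtain ⟨C, -, hC⟩ := q.norm_mul_pow_le_of_lt_radius hs
    refine Q.le_radius_of_bound C fun n ↦ le_trans ?_ (hC n)
    gcongr
    exact (q n).norm_pointwise_le
  obtain ⟨s, hs0, hsr⟩ : ∃ s : NNReal, 0 < s ∧ (s : ENNReal) < r := by
    obtain ⟨s, hs, hsr⟩ := ENNReal.lt_iff_exists_nnreal_btwn.1 hq.r_pos
    exact ⟨s, by exact_mod_cast hs, hsr⟩
  suffices hball : HasFPowerSeriesOnBall (compOperator K g) Q (ContinuousMap.const K e₀) s from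
    hball.analyticAt
  constructor
  · exact (hsr.le.trans hq.r_le).trans hQ
  · exact_mod_cast hs0
  intro h hh
  have hh' : h ∈ Metric.eball (0 : C(K, E)) Q.radius :=
    Metric.eball_subset_eball ((hsr.le.trans hq.r_le).trans hQ) hh
  have hsum := Q.hasSum hh'
  have hval (k : K) : Q.sum h k = g (e₀ + h k) := by
    have h1 : HasSum (fun n ↦ q n fun _ ↦ h k) (Q.sum h k) := ContinuousMap.hasSum_apply hsum k
    refine h1.unique (hq.hasSum ?_)
    have : ‖h‖ₑ < r := by
      refine lt_of_lt_of_le ?_ hsr.le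
      rwa [Metric.mem_eball, edist_zero_right] at hh
    have h2 : ‖h k‖ₑ ≤ ‖h‖ₑ := by
      simpa [enorm_le_iff_norm_le] using h.norm_coe_le_norm k
    simpa using h2.trans_lt this
  have hfun : g ∘ (ContinuousMap.const K e₀ + h : C(K, E)) = Q.sum h := by
    ext k; simp [hval]
  have : compOperator K g (ContinuousMap.const K e₀ + h) = Q.sum h := by
    ext k
    rw [compOperator_apply (hfun ▸ (Q.sum h).continuous), hval]; simp
  rw [this]; exact hsum

end CompositionOperator

/-! ### Analytic solutions along rays -/

section RadialSolution

open unitInterval MeasureTheory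

variable {W F : Type*} [NormedAddCommGroup W] [NormedSpace ℝ W]
  [NormedAddCommGroup F] [NormedSpace ℝ F]

/-- The Volterra operator `u ↦ (t ↦ ∫ s in 0..t, u s)` on `C([0, 1], F)`. -/
noncomputable def volterra (F : Type*) [NormedAddCommGroup F] [NormedSpace ℝ F] :
    C(I, F) →L[ℝ] C(I, F) :=
  LinearMap.mkContinuous
    { toFun := fun u ↦ ⟨fun t ↦ ∫ s in (0 : ℝ)..t, u (projIcc 0 1 zero_le_one s), by
        have hc : Continuous fun s : ℝ ↦ u (projIcc 0 1 zero_le_one s) :=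
          u.continuous.comp continuous_projIcc
        exact (intervalIntegral.continuous_primitive
          (fun a b ↦ hc.intervalIntegrable a b) 0).comp continuous_subtype_val⟩
      map_add' := fun u v ↦ by
        ext t
        simp only [ContinuousMap.add_apply, ContinuousMap.coe_mk]
        exact intervalIntegral.integral_add
          ((u.continuous.comp continuous_projIcc).intervalIntegrable _ _)
          ((v.continuous.comp continuous_projIcc).intervalIntegrable _ _)
      map_smul' := fun c u ↦ by
        ext t
        simp only [ContinuousMap.smul_apply, ContinuousMap.coe_mk, RingHom.id_apply]
        exact intervalIntegral.integral_smul c _ }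
    1 (fun u ↦ by
      refine (ContinuousMap.norm_le _ (by positivity)).2 fun t ↦ ?_
      refine (intervalIntegral.norm_integral_le_of_norm_le_const
        (C := ‖u‖) fun s _ ↦ u.norm_coe_le_norm _).trans ?_
      rw [sub_zero, abs_of_nonneg t.2.1, one_mul]
      exact mul_le_of_le_one_right (norm_nonneg _) t.2.2)

lemma volterra_apply (u : C(I, F)) (t : I) :
    volterra F u t = ∫ s in (0 : ℝ)..t, u (projIcc 0 1 zero_le_one s) := rfl

/-- The linear map sending `(w, z)` to the curve `s ↦ (w, s • w, z s)`. -/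
noncomputable def rayCurve (W F : Type*) [NormedAddCommGroup W] [NormedSpace ℝ W]
    [NormedAddCommGroup F] [NormedSpace ℝ F] :
    W × C(I, F) →L[ℝ] C(I, W × W × F) :=
  LinearMap.mkContinuous
    { toFun := fun p ↦ ⟨fun s ↦ (p.1, (s : ℝ) • p.1, p.2 s), by fun_prop⟩
      map_add' := fun p q ↦ by ext s <;> simp
      map_smul' := fun c p ↦ by ext s <;> simp [smul_comm (s : ℝ) c] }
    1 (fun p ↦ by
      refine (ContinuousMap.norm_le _ (by positivity)).2 fun s ↦ ?_
      have h1 : ‖(s : ℝ) • p.1‖ ≤ ‖p.1‖ := by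
        rw [norm_smul, Real.norm_of_nonneg s.2.1]
        exact mul_le_of_le_one_left (norm_nonneg _) s.2.2
      have h2 := p.2.norm_coe_le_norm s
      simp only [one_mul, LinearMap.coe_mk, AddHom.coe_mk, ContinuousMap.coe_mk, Prod.norm_def,
        max_le_iff]
      exact ⟨le_max_left _ _, h1.trans (le_max_left _ _), h2.trans (le_max_right _ _)⟩)

lemma rayCurve_apply (p : W × C(I, F)) (s : I) :
    rayCurve W F p s = (p.1, (s : ℝ) • p.1, p.2 s) := rfl

lemma norm_rayCurve_le (p : W × C(I, F)) : ‖rayCurve W F p‖ ≤ ‖p‖ := by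
  simpa using (rayCurve W F).le_of_opNorm_le (LinearMap.mkContinuous_norm_le _ zero_le_one _) p

/-- The map `(w, z) ↦ z - ∫ A(x₀.1 + s w, x₀.2 + z(s)) w ds`, whose zeros are the solutions of
`y' = A(x, y) x'`, `y(0) = x₀.2`, along the ray `s ↦ x₀.1 + s w`. -/
noncomputable def rayEquation (A : W × F → W →L[ℝ] F) (x₀ : W × F) (p : W × C(I, F)) : C(I, F) :=
  p.2 - volterra F (compOperator I (fun q : W × W × F ↦ A q.2 q.1)
    (ContinuousMap.const I (0, x₀) + rayCurve W F p))

lemma rayEquation_apply {A : W × F → W →L[ℝ] F} {x₀ : W × F} {r : ℝ}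
    (hA : ContinuousOn A (Metric.ball x₀ r)) {w : W} {z : C(I, F)} (hp : ‖(w, z)‖ < r) (t : I) :
    rayEquation A x₀ (w, z) t = z t - ∫ s in (0 : ℝ)..t,
      A (x₀.1 + (projIcc (0 : ℝ) 1 zero_le_one s : ℝ) • w,
        x₀.2 + z (projIcc 0 1 zero_le_one s)) w := by
  have hval (s : I) : (ContinuousMap.const I ((0 : W), x₀) + rayCurve W F (w, z)) s =
      (w, x₀.1 + (s : ℝ) • w, x₀.2 + z s) := by
    rw [ContinuousMap.add_apply, rayCurve_apply]
    ext <;> simp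
  have hmem (s : I) : (x₀.1 + (s : ℝ) • w, x₀.2 + z s) ∈ Metric.ball x₀ r := by
    have h1 := ((rayCurve W F (w, z)).norm_coe_le_norm s).trans (norm_rayCurve_le _)
    rw [rayCurve_apply, Prod.norm_def, max_le_iff] at h1
    rw [mem_ball_iff_norm]
    refine lt_of_le_of_lt (le_trans (le_of_eq ?_) h1.2) hp
    congr 1
    ext <;> simp
  have hcont : Continuous ((fun q : W × W × F ↦ A q.2 q.1) ∘
      (ContinuousMap.const I ((0 : W), x₀) + rayCurve W F (w, z))) := by
    have : Continuous fun s : I ↦ A (x₀.1 + (s : ℝ) • w, x₀.2 + z s) :=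
      hA.comp_continuous (by fun_prop) hmem
    convert this.clm_apply (continuous_const (y := w)) using 2 with s
    simp only [Function.comp, hval]
  rw [rayEquation, ContinuousMap.sub_apply, volterra_apply]
  congr 1
  refine intervalIntegral.integral_congr fun s _ ↦ ?_
  simp only [compOperator_apply hcont, hval]

variable [CompleteSpace W] [CompleteSpace F]

omit [CompleteSpace W] in
lemma contDiffAt_rayEquation {A : W × F → W →L[ℝ] F} {x₀ : W × F} (hA : ContDiffAt ℝ ω A x₀) :
    ContDiffAt ℝ ω (rayEquation A x₀) 0 := by
  have hg : ContDiffAt ℝ ω (fun q : W × W × F ↦ A q.2 q.1) (0, x₀) :=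
    (ContDiffAt.comp ((0 : W), x₀) hA contDiffAt_snd).clm_apply contDiffAt_fst
  have hcomp := (analyticAt_compOperator (K := I) hg.analyticAt).contDiffAt (n := ω)
  have hin : ContDiffAt ℝ ω
      (fun p ↦ ContinuousMap.const I ((0 : W), x₀) + rayCurve W F p) 0 :=
    contDiffAt_const.add (rayCurve W F).contDiff.contDiffAt
  have hout : ContDiffAt ℝ ω (compOperator I (fun q : W × W × F ↦ A q.2 q.1))
      (ContinuousMap.const I ((0 : W), x₀) + rayCurve W F 0) := by
    rwa [map_zero, add_zero]
  have hmid := ContDiffAt.comp (0 : W × C(I, F)) hout hin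
  exact contDiffAt_snd.sub (ContDiffAt.comp (0 : W × C(I, F))
    (volterra F).contDiff.contDiffAt hmid)

omit [CompleteSpace W] [CompleteSpace F] in
lemma rayEquation_zero_left (A : W × F → W →L[ℝ] F) (x₀ : W × F) (z : C(I, F)) :
    rayEquation A x₀ (0, z) = z := by
  have hval : (fun q : W × W × F ↦ A q.2 q.1) ∘
      (ContinuousMap.const I ((0 : W), x₀) + rayCurve W F (0, z)) = fun _ ↦ 0 := by
    ext s
    simp [rayCurve_apply]
  have hcont : Continuous ((fun q : W × W × F ↦ A q.2 q.1) ∘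
      (ContinuousMap.const I ((0 : W), x₀) + rayCurve W F (0, z))) := by
    rw [hval]; exact continuous_const
  have : compOperator I (fun q : W × W × F ↦ A q.2 q.1)
      (ContinuousMap.const I (0, x₀) + rayCurve W F (0, z)) = 0 := by
    ext s
    rw [compOperator_apply hcont]
    exact congrFun hval s
  rw [rayEquation, this, map_zero, sub_zero]

/-- The solutions of the Pfaffian system `dy = A(x, y) dx` along the rays from `x₀.1`, with
`y(x₀.1) = x₀.2`, depend analytically on the endpoint. They come from the analytic implicit
function theorem in `C([0, 1], F)`; rescaling a solution on a ray gives the solutions on shorter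
rays. -/
theorem exists_analytic_radial_solution {A : W × F → W →L[ℝ] F} {x₀ : W × F}
    (hA : ContDiffAt ℝ ω A x₀) :
    ∃ η : W → F, ContDiffAt ℝ ω η 0 ∧ η 0 = x₀.2 ∧
      ∀ᶠ w in 𝓝 0, fderiv ℝ η w w = A (x₀.1 + w, η w) w := by
  have hΦ := contDiffAt_rayEquation hA
  have hΦ0 : rayEquation A x₀ 0 = 0 := rayEquation_zero_left A x₀ 0
  have hinr : fderiv ℝ (rayEquation A x₀) 0 ∘L .inr ℝ W C(I, F) = .id ℝ _ := by
    have h1 : HasFDerivAt (rayEquation A x₀) (fderiv ℝ (rayEquation A x₀) 0)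
        (ContinuousLinearMap.inr ℝ W C(I, F) 0) := by
      rw [map_zero]; exact (hΦ.differentiableAt (by simp)).hasFDerivAt
    have h2 := h1.comp (0 : C(I, F)) (ContinuousLinearMap.inr ℝ W C(I, F)).hasFDerivAt
    have h3 : rayEquation A x₀ ∘ ContinuousLinearMap.inr ℝ W C(I, F) = id := by
      ext1 z; exact rayEquation_zero_left A x₀ z
    rw [h3] at h2
    exact h2.unique (hasFDerivAt_id _)
  have hinv : (fderiv ℝ (rayEquation A x₀) 0 ∘L .inr ℝ W C(I, F)).IsInvertible := by
    rw [hinr]; exact ⟨.refl ℝ _, rfl⟩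
  have hω : (ω : WithTop ℕ∞) ≠ 0 := by simp
  set ψ : W → C(I, F) := hΦ.implicitFunction hω hinv with hψdef
  have hψ : ContDiffAt ℝ ω ψ 0 := hΦ.contDiffAt_implicitFunction hω hinv
  have hψ0 : ψ 0 = 0 := hΦ.implicitFunction_apply_self hω hinv
  have hψeq : ∀ᶠ w in 𝓝 (0 : W), rayEquation A x₀ (w, ψ w) = 0 := by
    simpa [hΦ0] using hΦ.eventually_apply_implicitFunction hω hinv
  have hψiff : ∀ᶠ v in 𝓝 (0 : W × C(I, F)), rayEquation A x₀ v = 0 ↔ ψ v.1 = v.2 := by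
    simpa [hΦ0] using hΦ.eventually_apply_eq_iff_implicitFunction hω hinv
  obtain ⟨r, hr0, hr⟩ := Metric.eventually_nhds_iff_ball.1 (hA.eventually (by simp))
  have hAc : ContinuousOn A (Metric.ball x₀ r) := fun x hx ↦
    (hr x hx).continuousAt.continuousWithinAt
  obtain ⟨ε, hε0, hε⟩ := Metric.eventually_nhds_iff_ball.1 hψiff
  have hsmall : ∀ᶠ w in 𝓝 (0 : W), ‖(w, ψ w)‖ < min r ε := by
    have : ContinuousAt (fun w ↦ ‖(w, ψ w)‖) 0 :=
      (continuousAt_id.prodMk hψ.continuousAt).norm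
    refine this.eventually_lt_const ?_
    simp [hψ0, hr0, hε0]
  let η : W → F := fun w ↦ x₀.2 + ψ w 1
  have hev : ContDiff ℝ ω (fun u : C(I, F) ↦ u 1) :=
    (ContinuousMap.evalCLM ℝ (1 : I) : C(I, F) →L[ℝ] F).contDiff
  have hη : ContDiffAt ℝ ω η 0 :=
    contDiffAt_const.add (hev.contDiffAt.comp (0 : W) hψ)
  have hη0 : η 0 = x₀.2 := by simp [η, hψ0]
  have key : ∀ᶠ w in 𝓝 (0 : W), ∀ τ ∈ Ioo (0 : ℝ) 1,
      HasDerivAt (fun τ : ℝ ↦ η (τ • w)) (A (x₀.1 + τ • w, η (τ • w)) w) τ := by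
    filter_upwards [hψeq, hsmall] with w hw hws
    let h : ℝ → F := fun s ↦ A (x₀.1 + (projIcc (0 : ℝ) 1 zero_le_one s : ℝ) • w,
        x₀.2 + ψ w (projIcc 0 1 zero_le_one s)) w
    have hcont : Continuous h := by
      refine Continuous.clm_apply (hAc.comp_continuous ?_ ?_) continuous_const
      · have : Continuous (projIcc (0 : ℝ) 1 zero_le_one) := continuous_projIcc
        fun_prop
      · intro s
        rw [mem_ball_iff_norm]
        have h1 := ((rayCurve W F (w, ψ w)).norm_coe_le_norm
          (projIcc 0 1 zero_le_one s)).trans (norm_rayCurve_le _)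
        rw [rayCurve_apply, Prod.norm_def, max_le_iff] at h1
        refine lt_of_le_of_lt (le_trans (le_of_eq ?_) h1.2) (hws.trans_le (min_le_left _ _))
        congr 1
        ext <;> simp
    have hsol (t : I) : ψ w t = ∫ s in (0 : ℝ)..t, h s := by
      have := congrArg (fun u : C(I, F) ↦ u t) hw
      simp only [rayEquation_apply hAc (hws.trans_le (min_le_left _ _))] at this
      exact sub_eq_zero.1 this
    -- Rescaling `ψ w` by `τ` solves the equation along `τ • w`.
    have hscale (τ : I) : ψ ((τ : ℝ) • w) 1 = ψ w τ := by
      let z : C(I, F) := ⟨fun s ↦ ψ w (τ * s), by fun_prop⟩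
      have hz : ‖((τ : ℝ) • w, z)‖ < min r ε := by
        refine lt_of_le_of_lt ?_ hws
        rw [Prod.norm_def, Prod.norm_def]
        refine max_le_max ?_ ?_
        · rw [norm_smul, Real.norm_of_nonneg τ.2.1]
          exact mul_le_of_le_one_left (norm_nonneg _) τ.2.2
        · exact (ContinuousMap.norm_le _ (norm_nonneg _)).2 fun s ↦ (ψ w).norm_coe_le_norm _
      have hzero : rayEquation A x₀ ((τ : ℝ) • w, z) = 0 := by
        ext t
        rw [rayEquation_apply hAc (hz.trans_le (min_le_left _ _)), ContinuousMap.zero_apply,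
          sub_eq_zero]
        change ψ w (τ * t) = _
        rw [hsol]
        have := intervalIntegral.smul_integral_comp_mul_left (a := (0 : ℝ)) (b := t) h (τ : ℝ)
        rw [mul_zero] at this
        rw [Icc.coe_mul, ← this, ← intervalIntegral.integral_smul]
        refine intervalIntegral.integral_congr fun s hs ↦ ?_
        rw [uIcc_of_le t.2.1] at hs
        have hs1 : s ∈ I := ⟨hs.1, hs.2.trans t.2.2⟩
        have hs2 : (τ : ℝ) * s ∈ I := ⟨mul_nonneg τ.2.1 hs1.1, mul_le_one₀ τ.2.2 hs1.1 hs1.2⟩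
        have hp : (⟨(τ : ℝ) * s, hs2⟩ : I) = τ * ⟨s, hs1⟩ := rfl
        simp only [h, projIcc_of_mem zero_le_one hs1, projIcc_of_mem zero_le_one hs2, map_smul, z,
          ContinuousMap.coe_mk, hp, smul_smul, mul_comm s]
        rfl
      have := (hε ((τ : ℝ) • w, z) (by
        rw [mem_ball_zero_iff]; exact hz.trans_le (min_le_right _ _))).1 hzero
      simp only at this
      rw [this]
      simp [z]
    intro τ hτ
    have hτI : τ ∈ I := ⟨hτ.1.le, hτ.2.le⟩
    have h1 : HasDerivAt (fun t ↦ x₀.2 + ∫ s in (0 : ℝ)..t, h s) (h τ) τ :=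
      (intervalIntegral.integral_hasDerivAt_right (hcont.intervalIntegrable _ _)
        (hcont.stronglyMeasurableAtFilter _ _) hcont.continuousAt).const_add _
    have h2 (t : ℝ) (ht : t ∈ I) : η (t • w) = x₀.2 + ∫ s in (0 : ℝ)..t, h s := by
      rw [← hsol ⟨t, ht⟩, ← hscale ⟨t, ht⟩]
    have h3 : A (x₀.1 + τ • w, η (τ • w)) w = h τ := by
      simp only [h, projIcc_of_mem zero_le_one hτI]
      rw [← hscale ⟨τ, hτI⟩]
    rw [h3]
    refine h1.congr_of_eventuallyEq ?_
    filter_upwards [Ioo_mem_nhds hτ.1 hτ.2] with t ht using h2 t ⟨ht.1.le, ht.2.le⟩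
  -- The equation at `w` is read off at `τ = 1 / 2` on the ray through `2 • w`, as `τ = 1` is an
  -- end point.
  have key2 : ∀ᶠ w in 𝓝 (0 : W), ∀ τ ∈ Ioo (0 : ℝ) 1, HasDerivAt (fun τ : ℝ ↦ η (τ • (2 : ℝ) • w))
      (A (x₀.1 + τ • (2 : ℝ) • w, η (τ • (2 : ℝ) • w)) ((2 : ℝ) • w)) τ := by
    have : Filter.Tendsto (fun w : W ↦ (2 : ℝ) • w) (𝓝 0) (𝓝 0) := by
      simpa using (continuous_const_smul (2 : ℝ)).tendsto (0 : W)
    exact this.eventually key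
  clear_value η
  refine ⟨η, hη, hη0, ?_⟩
  filter_upwards [key2, hη.eventually (by simp)] with w hw hηw
  have h1 := hw (1 / 2) ⟨by norm_num, by norm_num⟩
  have h2 : (1 / 2 : ℝ) • (2 : ℝ) • w = w := by rw [smul_smul]; norm_num
  rw [h2] at h1
  have h3 : HasDerivAt (fun τ : ℝ ↦ τ • (2 : ℝ) • w) ((2 : ℝ) • w) (1 / 2) := by
    simpa using (hasDerivAt_id (1 / 2 : ℝ)).smul_const ((2 : ℝ) • w)
  have h4 : HasFDerivAt η (fderiv ℝ η w) ((1 / 2 : ℝ) • (2 : ℝ) • w) := by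
    rw [h2]; exact (hηw.differentiableAt (by simp)).hasFDerivAt
  have h5 : HasDerivAt (fun τ : ℝ ↦ η (τ • (2 : ℝ) • w)) _ (1 / 2) := h4.comp_hasDerivAt _ h3
  replace h5 := h5.unique h1
  rw [map_smul, map_smul] at h5
  exact smul_right_injective F (two_ne_zero : (2 : ℝ) ≠ 0) h5

end RadialSolution

/-! ### The curvature of a Pfaffian system and its integrability -/

section Pfaffian

variable {W F : Type*} [NormedAddCommGroup W] [NormedSpace ℝ W]
  [NormedAddCommGroup F] [NormedSpace ℝ F]

/-- The curvature of the Pfaffian system `dy = A(x, y) dx`: the vertical component of the Lie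
bracket of the horizontal vector fields `p ↦ (v, A(p) v)` and `p ↦ (w, A(p) w)`, whose horizontal
component is zero. -/
noncomputable def pfaffCurvature (A : W × F → W →L[ℝ] F) (v w : W) (p : W × F) : F :=
  fderiv ℝ A p (v, A p v) w - fderiv ℝ A p (w, A p w) v

/-- The vertical components of the iterated brackets `[X, [X, ..., [X, Y]]]`, where `X` and `Y` are
the horizontal vector fields `p ↦ (v, A(p) v)` and `p ↦ (w, A(p) w)`; index `0` stands for
`[X, Y]`. -/
noncomputable def iteratedCurvature (A : W × F → W →L[ℝ] F) (v w : W) : ℕ → W × F → F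
  | 0 => pfaffCurvature A v w
  | k + 1 => fun p ↦ fderiv ℝ (iteratedCurvature A v w k) p (v, A p v) -
      fderiv ℝ A p (0, iteratedCurvature A v w k p) v

lemma contDiffAt_iteratedCurvature [CompleteSpace F] {A : W × F → W →L[ℝ] F} {p : W × F}
    (hA : ContDiffAt ℝ ω A p) (v w : W) (k : ℕ) :
    ContDiffAt ℝ ω (iteratedCurvature A v w k) p := by
  have hA' : ContDiffAt ℝ ω (fderiv ℝ A) p := hA.fderiv_right (by simp)
  induction k with
  | zero =>
    exact ((hA'.clm_apply (contDiffAt_const.prodMk (hA.clm_apply contDiffAt_const))).clm_apply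
      contDiffAt_const).sub ((hA'.clm_apply (contDiffAt_const.prodMk
        (hA.clm_apply contDiffAt_const))).clm_apply contDiffAt_const)
  | succ k ih =>
    have ih' : ContDiffAt ℝ ω (fderiv ℝ (iteratedCurvature A v w k)) p :=
      ih.fderiv_right (by simp)
    exact (ih'.clm_apply (contDiffAt_const.prodMk (hA.clm_apply contDiffAt_const))).sub
      ((hA'.clm_apply (contDiffAt_const.prodMk ih)).clm_apply contDiffAt_const)

/-- Along the graph of a solution, the curvature and its iterates vanish. -/
theorem iteratedCurvature_eq_zero_of_solution [CompleteSpace F] {A : W × F → W →L[ℝ] F}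
    {O : Set W} (hO : IsOpen O) {y : W → F} (hA : ∀ x ∈ O, ContDiffAt ℝ ω A (x, y x))
    (hy : ∀ x ∈ O, HasFDerivAt y (A (x, y x)) x) (v w : W) (k : ℕ) :
    ∀ x ∈ O, iteratedCurvature A v w k (x, y x) = 0 := by
  have hG (x) (hx : x ∈ O) : HasFDerivAt (fun x ↦ (x, y x))
      ((ContinuousLinearMap.id ℝ W).prod (A (x, y x))) x := (hasFDerivAt_id x).prodMk (hy x hx)
  induction k with
  | zero =>
    intro x hx
    have h1 : HasFDerivAt (fun x ↦ A (x, y x)) (fderiv ℝ A (x, y x) ∘L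
        (ContinuousLinearMap.id ℝ W).prod (A (x, y x))) x :=
      HasFDerivAt.comp x ((hA x hx).differentiableAt (by simp)).hasFDerivAt (hG x hx)
    have h2 := second_derivative_symmetric_of_eventually
      (Filter.eventually_of_mem (hO.mem_nhds hx) hy) h1 v w
    simpa [iteratedCurvature, pfaffCurvature, sub_eq_zero] using h2
  | succ k ih =>
    intro x hx
    have h1 : HasFDerivAt (fun x ↦ iteratedCurvature A v w k (x, y x))
        (fderiv ℝ (iteratedCurvature A v w k) (x, y x) ∘L
          (ContinuousLinearMap.id ℝ W).prod (A (x, y x))) x :=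
      HasFDerivAt.comp x
        ((contDiffAt_iteratedCurvature (hA x hx) v w k).differentiableAt (by simp)).hasFDerivAt
        (hG x hx)
    have h2 : HasFDerivAt (fun x ↦ iteratedCurvature A v w k (x, y x)) (0 : W →L[ℝ] F) x :=
      (hasFDerivAt_const (0 : F) x).congr_of_eventuallyEq
        (Filter.eventually_of_mem (hO.mem_nhds hx) ih)
    have h3 := congrArg (fun L : W →L[ℝ] F ↦ L v) (h1.unique h2)
    simp only [ContinuousLinearMap.comp_apply, ContinuousLinearMap.prod_apply,
      ContinuousLinearMap.id_apply, zero_apply] at h3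
    simp only [iteratedCurvature, h3, ih x hx]
    rw [show ((0 : W), (0 : F)) = 0 from rfl]
    simp

/-- A sequence of analytic functions vanishing at `0` with `u j ' = u (j + 1) + B (u j)` vanishes
near `0`: every `u j` vanishes there to infinite order. -/
lemma eventually_eq_zero_of_deriv_chain [CompleteSpace F] {u : ℕ → ℝ → F} {B : ℝ → F →L[ℝ] F}
    (hu : ∀ j, AnalyticAt ℝ (u j) 0) (hB : AnalyticAt ℝ B 0) (h0 : ∀ j, u j 0 = 0)
    (hd : ∀ j, ∀ᶠ t in 𝓝 0, deriv (u j) t = u (j + 1) t + B t (u j t)) (j : ℕ) :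
    ∀ᶠ t in 𝓝 0, u j t = 0 := by
  have key (n : ℕ) : ∀ j, (n : ℕ∞) ≤ analyticOrderAt (u j) 0 := by
    induction n with
    | zero => simp
    | succ n ih =>
      intro j
      rw [Nat.cast_add, Nat.cast_one, ← analyticOrderAt_deriv_ge_iff (hu j) (h0 j),
        natCast_le_analyticOrderAt (hu j).deriv]
      obtain ⟨g, hg, hug⟩ := (natCast_le_analyticOrderAt (hu j)).1 (ih j)
      obtain ⟨g', hg', hug'⟩ := (natCast_le_analyticOrderAt (hu (j + 1))).1 (ih (j + 1))
      refine ⟨fun t ↦ g' t + B t (g t),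
        hg'.add (hB.contDiffAt.clm_apply hg.contDiffAt).analyticAt, ?_⟩
      filter_upwards [hd j, hug, hug'] with t h1 h2 h3
      rw [h1, h2, h3, map_smul, smul_add]
  exact analyticOrderAt_eq_top.1 (ENat.eq_top_iff_forall_ge.2 fun n ↦ key n j)

/-- If the curvature vanishes along the graph of a solution `η` of `dy = A(x, y) dx` along rays,
then `η` is a solution: the defect `Z = dη - A` satisfies a homogeneous linear differential
equation along rays. -/
lemma fderiv_eq_of_radial [CompleteSpace F] {A : W × F → W →L[ℝ] F} {a : W} {η : W → F} {ρ : ℝ}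
    (hη : ∀ x ∈ Metric.ball 0 ρ, ContDiffAt ℝ ω η x)
    (hA : ∀ x ∈ Metric.ball 0 ρ, ContDiffAt ℝ ω A (a + x, η x))
    (hrad : ∀ x ∈ Metric.ball 0 ρ, fderiv ℝ η x x = A (a + x, η x) x)
    (hcurv : ∀ x ∈ Metric.ball 0 ρ, ∀ v, pfaffCurvature A x v (a + x, η x) = 0)
    {x : W} (hx : x ∈ Metric.ball 0 ρ) : fderiv ℝ η x = A (a + x, η x) := by
  ext v
  set G : W → W × F := fun n ↦ (a + n, η n) with hGdef
  -- The defect of `η` in the direction `v`.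
  set Z : W → F := fun n ↦ fderiv ℝ η n v - A (G n) v with hZdef
  have hG (n) (hn : n ∈ Metric.ball (0 : W) ρ) :
      HasFDerivAt G ((ContinuousLinearMap.id ℝ W).prod (fderiv ℝ η n)) n :=
    ((hasFDerivAt_id n).const_add a).prodMk ((hη n hn).differentiableAt (by simp)).hasFDerivAt
  have hAG (n) (hn : n ∈ Metric.ball (0 : W) ρ) : HasFDerivAt (fun n ↦ A (G n))
      (fderiv ℝ A (G n) ∘L (ContinuousLinearMap.id ℝ W).prod (fderiv ℝ η n)) n :=
    HasFDerivAt.comp n ((hA n hn).differentiableAt (by simp)).hasFDerivAt (hG n hn)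
  have hη2 (n) (hn : n ∈ Metric.ball (0 : W) ρ) :
      HasFDerivAt (fderiv ℝ η) (fderiv ℝ (fderiv ℝ η) n) n :=
    (((hη n hn).fderiv_right (m := ω) (by simp)).differentiableAt (by simp)).hasFDerivAt
  let Z' : W → W →L[ℝ] F := fun n ↦ (fderiv ℝ (fderiv ℝ η) n).flip v -
    (fderiv ℝ A (G n) ∘L (ContinuousLinearMap.id ℝ W).prod (fderiv ℝ η n)).flip v
  have hZ (n) (hn : n ∈ Metric.ball (0 : W) ρ) : HasFDerivAt Z (Z' n) n := by
    have h1 := (hη2 n hn).clm_apply (hasFDerivAt_const v n)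
    have h2 := (hAG n hn).clm_apply (hasFDerivAt_const v n)
    have h3 := h1.sub h2
    simp only [ContinuousLinearMap.comp_zero, zero_add] at h3
    exact h3
  -- Differentiating the radial equation in the direction `v`; vanishing curvature removes the terms
  -- that do not contain `Z`.
  have hmain (n) (hn : n ∈ Metric.ball (0 : W) ρ) :
      Z n + Z' n n = fderiv ℝ A (G n) (0, Z n) n := by
    have h1 := ((hη2 n hn).clm_apply (hasFDerivAt_id n)).sub
      ((hAG n hn).clm_apply (hasFDerivAt_id n))
    have h2 := h1.unique ((hasFDerivAt_const (0 : F) n).congr_of_eventuallyEq <|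
      Filter.eventually_of_mem (Metric.isOpen_ball.mem_nhds hn) fun m hm ↦ by
        simpa [sub_eq_zero] using hrad m hm)
    have h3 := congrArg (fun L : W →L[ℝ] F ↦ L v) h2
    simp only [sub_apply, add_apply,
      ContinuousLinearMap.comp_apply, ContinuousLinearMap.id_apply,
      ContinuousLinearMap.flip_apply, ContinuousLinearMap.prod_apply,
      zero_apply, id] at h3
    have hsym : fderiv ℝ (fderiv ℝ η) n v n = fderiv ℝ (fderiv ℝ η) n n v :=
      (hη n hn).isSymmSndFDerivAt_of_omega v n
    have hc : fderiv ℝ A (G n) (n, A (G n) n) v - fderiv ℝ A (G n) (v, A (G n) v) n = 0 :=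
      hcurv n hn v
    have hsplit : (v, fderiv ℝ η n v) = (v, A (G n) v) + (0, Z n) := by
      ext <;> simp [hZdef]
    rw [hsplit, map_add, add_apply, hsym] at h3
    have hr : fderiv ℝ η n n = A (G n) n := hrad n hn
    simp only [Z', sub_apply, ContinuousLinearMap.comp_apply,
      ContinuousLinearMap.id_apply, ContinuousLinearMap.flip_apply,
      ContinuousLinearMap.prod_apply, hr]
    rw [sub_eq_zero] at hc
    rw [hc]
    have h4 : fderiv ℝ (fderiv ℝ η) n n v = fderiv ℝ A (G n) (v, A (G n) v) n +
        fderiv ℝ A (G n) (0, Z n) n + A (G n) v - fderiv ℝ η n v := by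
      rw [← sub_eq_zero, ← h3]; abel
    rw [h4]
    simp only [hZdef]
    abel
  have hseg (t : ℝ) (ht : t ∈ Icc (0 : ℝ) 1) : t • x ∈ Metric.ball (0 : W) ρ := by
    rw [mem_ball_zero_iff] at hx ⊢
    rw [norm_smul, Real.norm_of_nonneg ht.1]
    exact (mul_le_of_le_one_left (norm_nonneg _) ht.2).trans_lt hx
  -- The factor `t` absorbs the singularity at `0` of the equation for `Z` along the ray.
  have hζ (t : ℝ) (ht : t ∈ Icc (0 : ℝ) 1) : HasDerivAt (fun t : ℝ ↦ t • Z (t • x))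
      (fderiv ℝ A (G (t • x)) (0, t • Z (t • x)) x) t := by
    have h1 : HasDerivAt (fun t : ℝ ↦ t • x) x t := by
      simpa using (hasDerivAt_id t).smul_const x
    have h2 : HasDerivAt (fun t : ℝ ↦ Z (t • x)) (Z' (t • x) x) t :=
      HasFDerivAt.comp_hasDerivAt (l := Z) (f := fun t : ℝ ↦ t • x) t (hZ _ (hseg t ht)) h1
    convert! (hasDerivAt_id t).smul h2 using 1
    have h3 := hmain _ (hseg t ht)
    rw [map_smul, map_smul] at h3
    have h4 : ((0 : W), t • Z (t • x)) = t • ((0 : W), Z (t • x)) := by ext <;> simp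
    rw [h4, map_smul, smul_apply, ← h3]
    simp [add_comm]
  have hbd : ∃ C, ∀ t ∈ Icc (0 : ℝ) 1, ‖fderiv ℝ A (G (t • x))‖ ≤ C := by
    refine isCompact_Icc.exists_bound_of_continuousOn (f := fun t : ℝ ↦ fderiv ℝ A (G (t • x)))
      fun t ht ↦ ContinuousAt.continuousWithinAt ?_
    have h1 : ContinuousAt (fderiv ℝ A) (G (t • x)) :=
      ((hA _ (hseg t ht)).fderiv_right (m := ω) (by simp)).continuousAt
    have h2 : ContinuousAt (fun t : ℝ ↦ G (t • x)) t :=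
      ContinuousAt.comp (f := fun t : ℝ ↦ t • x) (hG _ (hseg t ht)).continuousAt (by fun_prop)
    exact ContinuousAt.comp (f := fun t : ℝ ↦ G (t • x)) h1 h2
  obtain ⟨C, hC⟩ := hbd
  have := eq_zero_of_abs_deriv_le_mul_abs_self_of_eq_zero_right (K := C * ‖x‖)
    (fun t ht ↦ (hζ t ht).continuousAt.continuousWithinAt)
    (fun t ht ↦ (hζ t ⟨ht.1, ht.2.le⟩).hasDerivWithinAt) (by simp) (fun t ht ↦ by
      refine (ContinuousLinearMap.le_opNorm _ _).trans ?_
      have h1 := (fderiv ℝ A (G (t • x))).le_opNorm (0, t • Z (t • x))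
      have h2 : ‖((0 : W), t • Z (t • x))‖ = ‖t • Z (t • x)‖ := by simp [Prod.norm_def]
      rw [h2] at h1
      calc _ ≤ (C * ‖t • Z (t • x)‖) * ‖x‖ := by
            gcongr
            exact h1.trans (by gcongr; exact hC t ⟨ht.1, ht.2.le⟩)
        _ = _ := by ring) 1 ⟨zero_le_one, le_rfl⟩
  simpa [hZdef, sub_eq_zero] using this

/-- **Pointwise Frobenius theorem for analytic Pfaffian systems.** If the iterated curvatures of
`dy = A(x, y) dx` vanish at the single point `x₀`, there is a solution through `x₀`: by analyticity
the curvature vanishes along the radial solution. -/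
theorem exists_solution_of_iteratedCurvature_eq_zero [CompleteSpace W] [CompleteSpace F]
    {A : W × F → W →L[ℝ] F} {x₀ : W × F} (hA : ContDiffAt ℝ ω A x₀)
    (hcurv : ∀ v w k, iteratedCurvature A v w k x₀ = 0) :
    ∃ y : W → F, y x₀.1 = x₀.2 ∧ ∀ᶠ x in 𝓝 x₀.1, HasFDerivAt y (A (x, y x)) x := by
  obtain ⟨η, hη, hη0, hrad⟩ := exists_analytic_radial_solution hA
  have hG : ContinuousAt (fun x ↦ (x₀.1 + x, η x)) 0 :=
    (continuousAt_const.add continuousAt_id).prodMk hη.continuousAt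
  have hG0 : (x₀.1 + 0, η 0) = x₀ := by rw [add_zero, hη0]
  have hAG : ∀ᶠ x in 𝓝 0, ContDiffAt ℝ ω A (x₀.1 + x, η x) := by
    have := hA.eventually (by simp)
    rw [← hG0] at this
    exact hG.eventually this
  obtain ⟨ρ, hρ0, hρ⟩ := Metric.eventually_nhds_iff_ball.1
    ((hη.eventually (by simp)).and (hAG.and hrad))
  have hηd (x) (hx : x ∈ Metric.ball (0 : W) ρ) := ((hρ x hx).1.differentiableAt (by simp))
  have hflat : ∀ x ∈ Metric.ball 0 ρ, ∀ v, pfaffCurvature A x v (x₀.1 + x, η x) = 0 := by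
    intro x hx v
    let S : Set ℝ := {t | t • x ∈ Metric.ball (0 : W) ρ}
    have hScont : Continuous fun t : ℝ ↦ t • x := by fun_prop
    have hSo : IsOpen S := Metric.isOpen_ball.preimage hScont
    have hSc : Convex ℝ S :=
      (convex_ball (0 : W) ρ).linear_preimage (LinearMap.toSpanSingleton ℝ W x)
    have h0S : (0 : ℝ) ∈ S := by simp [S, hρ0]
    have h1S : (1 : ℝ) ∈ S := by simpa [S] using hx
    -- The radial equation is homogeneous in the direction, so that at `t = 0` it needs continuity.
    have hray : ∀ t ∈ S, fderiv ℝ η (t • x) x = A (x₀.1 + t • x, η (t • x)) x := by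
      have hne : ∀ t ∈ S, t ≠ 0 → fderiv ℝ η (t • x) x - A (x₀.1 + t • x, η (t • x)) x = 0 := by
        intro t ht ht0
        have h1 := (hρ _ ht).2.2
        rw [map_smul, map_smul] at h1
        rw [sub_eq_zero]
        exact smul_right_injective F ht0 h1
      intro t ht
      rcases eq_or_ne t 0 with rfl | ht0
      · have hc : ContinuousAt
            (fun t : ℝ ↦ fderiv ℝ η (t • x) x - A (x₀.1 + t • x, η (t • x)) x) 0 := by
          have h1 : ContinuousAt (fderiv ℝ η) ((0 : ℝ) • x) :=
            ((hρ _ ht).1.fderiv_right (m := ω) (by simp)).continuousAt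
          have h2 : ContinuousAt (fun y ↦ A (x₀.1 + y, η y)) ((0 : ℝ) • x) := by
            refine ContinuousAt.comp (f := fun y ↦ (x₀.1 + y, η y)) (hρ _ ht).2.1.continuousAt ?_
            exact (continuousAt_const.add continuousAt_id).prodMk (hηd _ ht).continuousAt
          have h3 := ContinuousAt.comp (f := fun t : ℝ ↦ t • x) h1 hScont.continuousAt
          have h4 := ContinuousAt.comp (f := fun t : ℝ ↦ t • x) h2 hScont.continuousAt
          exact (h3.clm_apply continuousAt_const).sub (h4.clm_apply continuousAt_const)
        have hl := hc.tendsto.mono_left (nhdsWithin_le_nhds (s := {0}ᶜ))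
        have hz : Filter.Tendsto
            (fun t : ℝ ↦ fderiv ℝ η (t • x) x - A (x₀.1 + t • x, η (t • x)) x)
            (𝓝[{0}ᶜ] 0) (𝓝 0) := by
          refine tendsto_const_nhds.congr' ?_
          filter_upwards [self_mem_nhdsWithin,
            mem_nhdsWithin_of_mem_nhds (hSo.mem_nhds h0S)] with s hs hsS
          exact (hne s hsS hs).symm
        exact sub_eq_zero.1 (tendsto_nhds_unique hl hz)
      · exact sub_eq_zero.1 (hne t ht ht0)
    have hder (t) (ht : t ∈ S) : HasDerivAt (fun t : ℝ ↦ (x₀.1 + t • x, η (t • x)))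
        (x, A (x₀.1 + t • x, η (t • x)) x) t := by
      have h1 : HasDerivAt (fun t : ℝ ↦ t • x) x t := by
        simpa using (hasDerivAt_id t).smul_const x
      have h2 := (hηd _ ht).hasFDerivAt.comp_hasDerivAt t h1
      rw [hray t ht] at h2
      exact (h1.const_add _).prodMk h2
    have hGan (t) (ht : t ∈ S) : ContDiffAt ℝ ω (fun t : ℝ ↦ (x₀.1 + t • x, η (t • x))) t := by
      have h1 : ContDiffAt ℝ ω (fun t : ℝ ↦ t • x) t := by fun_prop
      exact (contDiffAt_const.add h1).prodMk ((hρ _ ht).1.comp t h1)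
    -- Along the lifted ray, which is an integral curve of the horizontal field over `x`, the
    -- derivative of each iterated curvature is the next one, up to a term linear in the former.
    let u : ℕ → ℝ → F := fun j t ↦ iteratedCurvature A x v j (x₀.1 + t • x, η (t • x))
    have hu (j) (t) (ht : t ∈ S) : AnalyticAt ℝ (u j) t :=
      (ContDiffAt.comp t (contDiffAt_iteratedCurvature (hρ _ ht).2.1 x v j)
        (hGan t ht)).analyticAt
    let B : ℝ → F →L[ℝ] F := fun t ↦
      (fderiv ℝ A (x₀.1 + t • x, η (t • x)) ∘L ContinuousLinearMap.inr ℝ W F).flip x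
    have hB : AnalyticAt ℝ B 0 := by
      have h1 : ContDiffAt ℝ ω (fun t : ℝ ↦ fderiv ℝ A (x₀.1 + t • x, η (t • x))) 0 :=
        ContDiffAt.comp (g := fderiv ℝ A) (0 : ℝ)
          ((hρ _ h0S).2.1.fderiv_right (m := ω) (by simp)) (hGan 0 h0S)
      have h2 := h1.clm_comp (contDiffAt_const (c := ContinuousLinearMap.inr ℝ W F))
      have h3 := (ContinuousLinearMap.flipₗᵢ ℝ F W F).contDiff.contDiffAt.comp (0 : ℝ) h2
      exact (h3.clm_apply contDiffAt_const).analyticAt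
    have hzero := eventually_eq_zero_of_deriv_chain (u := u) (B := B) (fun j ↦ hu j 0 h0S) hB
      (fun j ↦ by simpa [u, hη0] using hcurv x v j)
      (fun j ↦ by
        filter_upwards [hSo.mem_nhds h0S] with t ht
        have h1 := ((contDiffAt_iteratedCurvature (hρ _ ht).2.1 x v j).differentiableAt
          (by simp)).hasFDerivAt.comp_hasDerivAt t (hder t ht)
        rw [show deriv (u j) t = _ from h1.deriv]
        simp [u, B, iteratedCurvature]) 0
    have hS := AnalyticOnNhd.eqOn_zero_of_preconnected_of_eventuallyEq_zero
      (fun t ht ↦ hu 0 t ht) hSc.isPreconnected h0S hzero h1S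
    simpa [u, iteratedCurvature] using hS
  have hfd (x) (hx : x ∈ Metric.ball (0 : W) ρ) : fderiv ℝ η x = A (x₀.1 + x, η x) :=
    fderiv_eq_of_radial (fun x hx ↦ (hρ x hx).1) (fun x hx ↦ (hρ x hx).2.1)
      (fun x hx ↦ (hρ x hx).2.2) hflat hx
  refine ⟨fun x ↦ η (x - x₀.1), by simp [hη0], ?_⟩
  filter_upwards [Metric.ball_mem_nhds x₀.1 hρ0] with x hx
  have hx' : x - x₀.1 ∈ Metric.ball (0 : W) ρ := by
    rwa [mem_ball_zero_iff, ← mem_ball_iff_norm]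
  have h1 := (hηd _ hx').hasFDerivAt
  rw [hfd _ hx', add_sub_cancel] at h1
  have h2 : HasFDerivAt (fun x ↦ x - x₀.1) (ContinuousLinearMap.id ℝ W) x :=
    (hasFDerivAt_id x).sub_const _
  exact HasFDerivAt.comp (f := fun x ↦ x - x₀.1) x h1 h2

end Pfaffian

/-! ### Uniqueness and smoothness of solutions -/

section PfaffianUniqueness

variable {W F : Type*} [NormedAddCommGroup W] [NormedSpace ℝ W]
  [NormedAddCommGroup F] [NormedSpace ℝ F]

/-- A curve that vanishes at `t₀` and satisfies `‖δ'‖ ≤ K ‖δ‖` to the right of `t₀` vanishes to the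
right of `t₀`. Differentiability at `t₀` itself is not assumed. -/
lemma eventually_nhdsGT_eq_zero_of_norm_deriv_le {δ δ' : ℝ → F} {K t₀ : ℝ}
    (hc : ContinuousAt δ t₀) (h0 : δ t₀ = 0)
    (hd : ∀ᶠ t in 𝓝[>] t₀, HasDerivAt δ (δ' t) t ∧ ‖δ' t‖ ≤ K * ‖δ t‖) :
    ∀ᶠ t in 𝓝[>] t₀, δ t = 0 := by
  obtain ⟨b, hb, hb'⟩ := mem_nhdsGT_iff_exists_Ioo_subset.1 hd
  have hb0 : t₀ < b := hb
  -- The bound forces `δ'` to tend to `0` at `t₀`, so `0` is the right derivative there.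
  have hder0 : HasDerivWithinAt δ 0 (Ici t₀) t₀ := by
    refine hasDerivWithinAt_Ici_of_tendsto_deriv (s := Ioo t₀ b)
      (fun t ht ↦ (hb' ht).1.differentiableAt.differentiableWithinAt) hc.continuousWithinAt
      (Ioo_mem_nhdsGT hb0) ?_
    have h1 : Filter.Tendsto (fun t ↦ K * ‖δ t‖) (𝓝[>] t₀) (𝓝 0) := by
      have h2 : ContinuousAt (fun t ↦ K * ‖δ t‖) t₀ := continuousAt_const.mul hc.norm
      have h3 := h2.tendsto.mono_left (nhdsWithin_le_nhds (s := Ioi t₀))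
      simpa [h0] using h3
    refine squeeze_zero_norm' ?_ h1
    filter_upwards [hd] with t ht
    rw [ht.1.deriv]; exact ht.2
  have hzero : ∀ t ∈ Ioo t₀ b, δ t = 0 := by
    intro t ht
    let d : ℝ → F := fun s ↦ if s = t₀ then 0 else δ' s
    refine eq_zero_of_abs_deriv_le_mul_abs_self_of_eq_zero_right (f := δ) (f' := d) (a := t₀)
      (b := t) (K := K) ?_ ?_ h0 ?_ t ⟨ht.1.le, le_rfl⟩
    · intro s hs
      rcases eq_or_lt_of_le hs.1 with rfl | hs'
      · exact hc.continuousWithinAt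
      · exact (hb' ⟨hs', hs.2.trans_lt ht.2⟩).1.continuousAt.continuousWithinAt
    · intro s hs
      rcases eq_or_lt_of_le hs.1 with rfl | hs'
      · simpa [d] using hder0
      · simpa [d, hs'.ne'] using (hb' ⟨hs', hs.2.trans ht.2⟩).1.hasDerivWithinAt
    · intro s hs
      rcases eq_or_lt_of_le hs.1 with rfl | hs'
      · simp [d, h0]
      · simpa [d, hs'.ne'] using (hb' ⟨hs', hs.2.trans ht.2⟩).2
  filter_upwards [Ioo_mem_nhdsGT hb0] with t ht using hzero t ht

lemma eventually_eq_zero_of_norm_deriv_le {δ δ' : ℝ → F} {K t₀ : ℝ}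
    (hc : ContinuousAt δ t₀) (h0 : δ t₀ = 0)
    (hd : ∀ᶠ t in 𝓝[≠] t₀, HasDerivAt δ (δ' t) t ∧ ‖δ' t‖ ≤ K * ‖δ t‖) :
    ∀ᶠ t in 𝓝 t₀, δ t = 0 := by
  rw [← Iio_union_Ioi, nhdsWithin_union, Filter.eventually_sup] at hd
  have hright := eventually_nhdsGT_eq_zero_of_norm_deriv_le hc h0 hd.2
  have hneg : Filter.Tendsto (fun t : ℝ ↦ -t) (𝓝[>] (-t₀)) (𝓝[<] t₀) := by
    have := tendsto_neg_nhdsGT (a := -t₀)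
    rwa [neg_neg] at this
  have hleft : ∀ᶠ t in 𝓝[>] (-t₀), δ (-t) = 0 := by
    refine eventually_nhdsGT_eq_zero_of_norm_deriv_le (δ := fun t ↦ δ (-t))
      (δ' := fun t ↦ -δ' (-t)) (K := K) ?_ (by simpa using h0) ?_
    · exact ContinuousAt.comp (f := fun t : ℝ ↦ -t) (by simpa using hc) continuous_neg.continuousAt
    · filter_upwards [hneg.eventually hd.1] with t ht
      refine ⟨?_, by simpa using ht.2⟩
      have h1 := HasDerivAt.scomp (g₁ := δ) (h := fun t : ℝ ↦ -t) t ht.1 (hasDerivAt_neg t)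
      rw [neg_one_smul] at h1
      exact h1
  have hleft' : ∀ᶠ t in 𝓝[<] t₀, δ t = 0 := by
    have := tendsto_neg_nhdsLT (a := t₀)
    simpa using this.eventually hleft
  have : ∀ᶠ t in 𝓝[≠] t₀, δ t = 0 := by
    rw [← Iio_union_Ioi, nhdsWithin_union, Filter.eventually_sup]
    exact ⟨hleft', hright⟩
  rw [← nhdsNE_sup_pure, Filter.eventually_sup]
  exact ⟨this, h0⟩

/-- A horizontal curve `t ↦ (x t, z t)` that meets the graph of a solution `y` of the Pfaffian
system stays on it. The curve may have a corner at the meeting time. -/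
theorem eventually_eq_solution_of_curve {A : W × F → W →L[ℝ] F} {y : W → F} {x x' : ℝ → W}
    {z : ℝ → F} {t₀ : ℝ} (hA : ContDiffAt ℝ 1 A (x t₀, y (x t₀)))
    (hy : ∀ᶠ p in 𝓝 (x t₀), HasFDerivAt y (A (p, y p)) p)
    (hx : ∀ᶠ t in 𝓝 t₀, HasDerivAt x (x' t) t) (hx' : ContinuousAt x' t₀)
    (hz : ContinuousAt z t₀) (hz0 : z t₀ = y (x t₀))
    (hz' : ∀ᶠ t in 𝓝[≠] t₀, HasDerivAt z (A (x t, z t) (x' t)) t) :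
    ∀ᶠ t in 𝓝 t₀, z t = y (x t) := by
  obtain ⟨K, s, hs, hK⟩ := hA.exists_lipschitzOnWith
  have hxc : ContinuousAt x t₀ := hx.self_of_nhds.continuousAt
  have hyc : ContinuousAt y (x t₀) := hy.self_of_nhds.continuousAt
  have hyx : ContinuousAt (fun t ↦ y (x t)) t₀ := ContinuousAt.comp (f := x) hyc hxc
  have hs1 : ∀ᶠ t in 𝓝 t₀, (x t, y (x t)) ∈ s := (hxc.prodMk hyx).eventually hs
  have hs2 : ∀ᶠ t in 𝓝 t₀, (x t, z t) ∈ s :=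
    (hxc.prodMk hz).eventually (by simpa only [hz0] using! hs)
  have hbd : ∀ᶠ t in 𝓝 t₀, ‖x' t‖ < ‖x' t₀‖ + 1 :=
    hx'.norm.eventually_lt_const (by linarith)
  have key := eventually_eq_zero_of_norm_deriv_le (δ := fun t ↦ z t - y (x t))
    (δ' := fun t ↦ A (x t, z t) (x' t) - A (x t, y (x t)) (x' t))
    (K := K * (‖x' t₀‖ + 1)) (t₀ := t₀) (hz.sub hyx) (by simp [hz0]) (by
      filter_upwards [hz', nhdsWithin_le_nhds hx, nhdsWithin_le_nhds hs1,
        nhdsWithin_le_nhds hs2, nhdsWithin_le_nhds hbd,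
        nhdsWithin_le_nhds (hxc.eventually hy)] with t h1 h2 h3 h4 h5 h6
      refine ⟨h1.sub (HasFDerivAt.comp_hasDerivAt (l := y) t h6 h2), ?_⟩
      rw [← sub_apply]
      refine (ContinuousLinearMap.le_opNorm _ _).trans ?_
      have h7 := hK.norm_sub_le h4 h3
      have h8 : ‖(x t, z t) - (x t, y (x t))‖ = ‖z t - y (x t)‖ := by simp [Prod.norm_def]
      rw [h8] at h7
      calc _ ≤ (K * ‖z t - y (x t)‖) * (‖x' t₀‖ + 1) := by gcongr
        _ = _ := by ring)
  filter_upwards [key] with t ht using sub_eq_zero.1 ht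

/-- Two solutions of a Pfaffian system that agree at a point agree near it. -/
theorem eventuallyEq_of_solutions {A : W × F → W →L[ℝ] F} {y₁ y₂ : W → F} {x₀ : W}
    (hA : ContDiffAt ℝ 1 A (x₀, y₁ x₀))
    (h₁ : ∀ᶠ p in 𝓝 x₀, HasFDerivAt y₁ (A (p, y₁ p)) p)
    (h₂ : ∀ᶠ p in 𝓝 x₀, HasFDerivAt y₂ (A (p, y₂ p)) p) (h0 : y₁ x₀ = y₂ x₀) :
    y₁ =ᶠ[𝓝 x₀] y₂ := by
  obtain ⟨K, s, hs, hK⟩ := hA.exists_lipschitzOnWith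
  have hs1 : ∀ᶠ p in 𝓝 x₀, (p, y₁ p) ∈ s :=
    (continuousAt_id.prodMk h₁.self_of_nhds.continuousAt).eventually hs
  have hs2 : ∀ᶠ p in 𝓝 x₀, (p, y₂ p) ∈ s :=
    (continuousAt_id.prodMk h₂.self_of_nhds.continuousAt).eventually
      (by simpa only [id, ← h0] using! hs)
  obtain ⟨r, hr0, hr⟩ := Metric.eventually_nhds_iff_ball.1 (h₁.and (h₂.and (hs1.and hs2)))
  filter_upwards [Metric.ball_mem_nhds x₀ hr0] with p hp
  have hseg (t : ℝ) (ht : t ∈ Icc (0 : ℝ) 1) : x₀ + t • (p - x₀) ∈ Metric.ball x₀ r := by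
    rw [mem_ball_iff_norm] at hp ⊢
    rw [add_sub_cancel_left, norm_smul, Real.norm_of_nonneg ht.1]
    exact (mul_le_of_le_one_left (norm_nonneg _) ht.2).trans_lt hp
  let x : ℝ → W := fun t ↦ x₀ + t • (p - x₀)
  have hx (t : ℝ) : HasDerivAt x (p - x₀) t := by
    have h1 := ((hasDerivAt_id t).smul_const (p - x₀)).const_add x₀
    rwa [one_smul] at h1
  have hd (t : ℝ) (ht : t ∈ Icc (0 : ℝ) 1) : HasDerivAt (fun t ↦ y₁ (x t) - y₂ (x t))
      (A (x t, y₁ (x t)) (p - x₀) - A (x t, y₂ (x t)) (p - x₀)) t :=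
    (HasFDerivAt.comp_hasDerivAt (l := y₁) t (hr _ (hseg t ht)).1 (hx t)).sub
      (HasFDerivAt.comp_hasDerivAt (l := y₂) t (hr _ (hseg t ht)).2.1 (hx t))
  have := eq_zero_of_abs_deriv_le_mul_abs_self_of_eq_zero_right (K := K * ‖p - x₀‖)
    (fun t ht ↦ (hd t ht).continuousAt.continuousWithinAt)
    (fun t ht ↦ (hd t ⟨ht.1, ht.2.le⟩).hasDerivWithinAt) (by simp [x, h0]) (fun t ht ↦ by
      rw [← sub_apply]
      refine (ContinuousLinearMap.le_opNorm _ _).trans ?_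
      have hm := (hr _ (hseg t ⟨ht.1, ht.2.le⟩)).2.2
      have h7 := hK.norm_sub_le hm.1 hm.2
      have h8 : ‖(x t, y₁ (x t)) - (x t, y₂ (x t))‖ = ‖y₁ (x t) - y₂ (x t)‖ := by
        rw [Prod.mk_sub_mk, sub_self, Prod.norm_def, norm_zero, max_eq_right (norm_nonneg _)]
      change _ ≤ K * ‖(x t, y₁ (x t)) - (x t, y₂ (x t))‖ at h7
      rw [h8] at h7
      calc _ ≤ (K * ‖y₁ (x t) - y₂ (x t)‖) * ‖p - x₀‖ := by gcongr
        _ = _ := by ring) 1 ⟨zero_le_one, le_rfl⟩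
  simpa [x, sub_eq_zero] using this

/-- Solutions of a smooth Pfaffian system are smooth, since `dy = A(x, y)` is as regular as `y`. -/
theorem contDiffOn_of_solution {A : W × F → W →L[ℝ] F} {y : W → F} {O : Set W} (hO : IsOpen O)
    (hA : ∀ x ∈ O, ContDiffAt ℝ ∞ A (x, y x))
    (hy : ∀ x ∈ O, HasFDerivAt y (A (x, y x)) x) : ContDiffOn ℝ ∞ y O := by
  refine contDiffOn_infty.2 fun n ↦ ?_
  induction n with
  | zero => exact contDiffOn_zero.2 fun x hx ↦ (hy x hx).continuousAt.continuousWithinAt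
  | succ n ih =>
    rw [Nat.cast_add, Nat.cast_one]
    refine (contDiffOn_succ_iff_fderiv_of_isOpen hO).2
      ⟨fun x hx ↦ (hy x hx).differentiableAt.differentiableWithinAt, by simp, ?_⟩
    have h1 : ContDiffOn ℝ n (fun x ↦ A (x, y x)) O := fun x hx ↦
      ContDiffAt.comp_contDiffWithinAt (f := fun x ↦ (x, y x)) x
        ((hA x hx).of_le (by exact_mod_cast le_top)) (contDiffWithinAt_id.prodMk (ih x hx))
    exact h1.congr fun x hx ↦ (hy x hx).fderiv

end PfaffianUniqueness

/-! ### Charts adapted to a horizontal distribution -/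

section AdaptedChart

variable {V W : Type*} [NormedAddCommGroup V] [NormedSpace ℝ V]
  [NormedAddCommGroup W] [NormedSpace ℝ W]
  {E : Type*} [TopologicalSpace E] [ChartedSpace V E]
  {M : Type*} [TopologicalSpace M] [ChartedSpace W M]

/-- An analytic chart of `E` with values in `W × F` in which `π` is the first projection, together
with the analytic family `slope` of linear maps `W → F` whose graphs represent `D`. -/
structure AdaptedChart (F : Type*) [NormedAddCommGroup F] [NormedSpace ℝ F]
    (π : E → M) (D : ∀ x : E, Submodule ℝ (TangentSpace 𝓘(ℝ, V) x)) where
  /-- The chart of the total space. -/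
  chart : OpenPartialHomeomorph E (W × F)
  /-- The chart of the base. -/
  baseChart : OpenPartialHomeomorph M W
  /-- The linear map whose graph represents `D`. -/
  slope : W × F → W →L[ℝ] F
  contMDiffOn_chart : ContMDiffOn 𝓘(ℝ, V) 𝓘(ℝ, W × F) ω chart chart.source
  contMDiffOn_chart_symm : ContMDiffOn 𝓘(ℝ, W × F) 𝓘(ℝ, V) ω chart.symm chart.target
  contMDiffOn_baseChart : ContMDiffOn 𝓘(ℝ, W) 𝓘(ℝ, W) ω baseChart baseChart.source
  contMDiffOn_baseChart_symm : ContMDiffOn 𝓘(ℝ, W) 𝓘(ℝ, W) ω baseChart.symm baseChart.target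
  mapsTo_source : MapsTo π chart.source baseChart.source
  baseChart_apply : ∀ x ∈ chart.source, baseChart (π x) = (chart x).1
  contDiffAt_slope : ∀ p ∈ chart.target, ContDiffAt ℝ ω slope p
  mem_iff : ∀ x ∈ chart.source, ∀ ξ : TangentSpace 𝓘(ℝ, V) x, ξ ∈ D x ↔
    (mfderiv 𝓘(ℝ, V) 𝓘(ℝ, W × F) chart x ξ : W × F).2 =
      slope (chart x) (mfderiv 𝓘(ℝ, V) 𝓘(ℝ, W × F) chart x ξ : W × F).1

lemma OpenPartialHomeomorph.mdifferentiable_of_contMDiffOn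
    {V₁ V₂ : Type*} [NormedAddCommGroup V₁] [NormedSpace ℝ V₁]
    [NormedAddCommGroup V₂] [NormedSpace ℝ V₂] {X : Type*} [TopologicalSpace X]
    [ChartedSpace V₁ X] {Y : Type*} [TopologicalSpace Y] [ChartedSpace V₂ Y]
    {φ : OpenPartialHomeomorph X Y} {n : WithTop ℕ∞} (hn : n ≠ 0)
    (h : ContMDiffOn 𝓘(ℝ, V₁) 𝓘(ℝ, V₂) n φ φ.source)
    (h' : ContMDiffOn 𝓘(ℝ, V₂) 𝓘(ℝ, V₁) n φ.symm φ.target) :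
    φ.MDifferentiable 𝓘(ℝ, V₁) 𝓘(ℝ, V₂) :=
  ⟨h.mdifferentiableOn hn, h'.mdifferentiableOn hn⟩

/-- An analytic vector field, read in an analytic chart with values in a vector space, is
analytic. -/
lemma contDiffAt_vectorField_in_chart {V' : Type*} [NormedAddCommGroup V'] [NormedSpace ℝ V']
    [CompleteSpace V] [CompleteSpace V'] [IsManifold 𝓘(ℝ, V) ω E]
    {φ : OpenPartialHomeomorph E V'}
    (hφ : ContMDiffOn 𝓘(ℝ, V) 𝓘(ℝ, V') ω φ φ.source)
    (hφ' : ContMDiffOn 𝓘(ℝ, V') 𝓘(ℝ, V) ω φ.symm φ.target)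
    {X : ∀ x : E, TangentSpace 𝓘(ℝ, V) x} {p : V'} (hp : p ∈ φ.target)
    (hX : ContMDiffAt 𝓘(ℝ, V) 𝓘(ℝ, V).tangent ω
        (fun x ↦ (⟨x, X x⟩ : TangentBundle 𝓘(ℝ, V) E)) (φ.symm p)) :
    ContDiffAt ℝ ω (fun q ↦ (mfderiv 𝓘(ℝ, V) 𝓘(ℝ, V') φ (φ.symm q) (X (φ.symm q)) : V')) p := by
  have hd := OpenPartialHomeomorph.mdifferentiable_of_contMDiffOn (by simp) hφ hφ'
  have hinv (q : V') (hq : q ∈ φ.target) :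
      (mfderiv 𝓘(ℝ, V') 𝓘(ℝ, V) φ.symm q).inverse =
        (mfderiv 𝓘(ℝ, V) 𝓘(ℝ, V') φ (φ.symm q) :) := by
    refine ContinuousLinearMap.inverse_eq ?_ ?_
    · have := hd.symm_comp_deriv (φ.map_target hq)
      rwa [φ.right_inv hq] at this
    · exact hd.comp_symm_deriv hq
  have hI : (mfderiv 𝓘(ℝ, V') 𝓘(ℝ, V) φ.symm p).IsInvertible :=
    ⟨hd.symm.mfderiv hp, rfl⟩
  have : IsManifold 𝓘(ℝ, V) 1 E := IsManifold.of_le (n := ω) le_top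
  have h1 := hX.mpullback_vectorField_preimage
    (hφ'.contMDiffAt (φ.open_target.mem_nhds hp)) hI (by simp)
  rw [contMDiffAt_vectorSpace_iff_contDiffAt] at h1
  refine h1.congr_of_eventuallyEq ?_
  filter_upwards [φ.open_target.mem_nhds hp] with q hq
  rw [VectorField.mpullback_apply, hinv q hq]
  rfl

variable {π : E → M} {D : ∀ x : E, Submodule ℝ (TangentSpace 𝓘(ℝ, V) x)}

/-- Adapted charts exist around each point: the submersion provides charts in which `π` is a
projection. A local frame of `D`, read in such a chart, is given by matrices `a p` and `b p` with
values in `W` and `F`; horizontality makes `a p` invertible, and `D` is the graph of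
`b p ∘ (a p)⁻¹`. -/
theorem exists_adaptedChart [FiniteDimensional ℝ V] [FiniteDimensional ℝ W]
    [IsManifold 𝓘(ℝ, V) ω E] [IsManifold 𝓘(ℝ, W) ω M]
    {F : Type*} [NormedAddCommGroup F] [NormedSpace ℝ F] [CompleteSpace F]
    (hD : IsAnalyticDistribution D) (hDπ : IsHorizontalDistribution (W := W) π D)
    {e : E} (h : IsSubmersionAtOfComplement F 𝓘(ℝ, V) 𝓘(ℝ, W) ω π e)
    (hπ : ContMDiff 𝓘(ℝ, V) 𝓘(ℝ, W) ω π) :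
    ∃ a : AdaptedChart (W := W) F π D, e ∈ a.chart.source := by
  have : CompleteSpace V := FiniteDimensional.complete ℝ V
  have : CompleteSpace W := FiniteDimensional.complete ℝ W
  obtain ⟨U, hU, heU, k, X, hX, hspan⟩ := hD e
  set L := h.equiv
  set ψ := h.codChart
  have hψ := h.codChart_mem_maximalAtlas
  have hφ := h.domChart_mem_maximalAtlas
  set chart : OpenPartialHomeomorph E (W × F) :=
    (h.domChart.transHomeomorph L.toHomeomorph).restrOpen U hU with hchart
  have hcoe : (chart : E → W × F) = L ∘ h.domChart := rfl
  have hcoe' : (chart.symm : W × F → E) = h.domChart.symm ∘ L.symm := rfl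
  have h1 : ContMDiffOn 𝓘(ℝ, V) 𝓘(ℝ, W × F) ω chart chart.source := by
    rw [hcoe]
    exact L.contDiff.contMDiff.comp_contMDiffOn
      ((contMDiffOn_of_mem_maximalAtlas hφ).mono inter_subset_left)
  have htarget : MapsTo L.symm chart.target h.domChart.target := by
    exact fun p hp ↦ hp.1
  have h2 : ContMDiffOn 𝓘(ℝ, W × F) 𝓘(ℝ, V) ω chart.symm chart.target := by
    rw [hcoe']
    exact (contMDiffOn_symm_of_mem_maximalAtlas hφ).comp
      L.symm.contDiff.contMDiff.contMDiffOn htarget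
  have hd := OpenPartialHomeomorph.mdifferentiable_of_contMDiffOn (by simp) h1 h2
  have hψd : ψ.MDifferentiable 𝓘(ℝ, W) 𝓘(ℝ, W) :=
    OpenPartialHomeomorph.mdifferentiable_of_contMDiffOn (n := ω) (by simp)
      (contMDiffOn_of_mem_maximalAtlas hψ) (contMDiffOn_symm_of_mem_maximalAtlas hψ)
  have hmaps : MapsTo π chart.source ψ.source := fun x hx ↦ h.source_subset_preimage_source hx.1
  have hproj : ∀ x ∈ chart.source, ψ (π x) = (chart x).1 := by
    intro x hx
    have hx' : h.domChart x ∈ (h.domChart.extend 𝓘(ℝ, V)).target := by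
      simpa using h.domChart.map_source hx.1
    have := h.writtenInCharts hx'
    simp only [OpenPartialHomeomorph.extend_coe, OpenPartialHomeomorph.extend_coe_symm,
      modelWithCornersSelf_coe, modelWithCornersSelf_coe_symm, Function.comp_apply, id,
      h.domChart.left_inv hx.1] at this
    exact this
  let d (x : E) : TangentSpace 𝓘(ℝ, V) x →L[ℝ] W × F := mfderiv 𝓘(ℝ, V) 𝓘(ℝ, W × F) chart x
  have hdproj (x) (hx : x ∈ chart.source) (ξ : TangentSpace 𝓘(ℝ, V) x) :
      (d x ξ).1 = mfderiv 𝓘(ℝ, W) 𝓘(ℝ, W) ψ (π x) (mfderiv 𝓘(ℝ, V) 𝓘(ℝ, W) π x ξ) := by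
    have e1 : HasMFDerivAt 𝓘(ℝ, V) 𝓘(ℝ, W) (Prod.fst ∘ chart) x
        ((ContinuousLinearMap.fst ℝ W F).comp (d x)) :=
      HasMFDerivAt.comp x (ContinuousLinearMap.fst ℝ W F).hasMFDerivAt
        (hd.mdifferentiableAt hx).hasMFDerivAt
    have e2 := HasMFDerivAt.comp x (hψd.mdifferentiableAt (hmaps hx)).hasMFDerivAt
      (hπ.mdifferentiable (by simp) x).hasMFDerivAt
    have e3 : (Prod.fst ∘ chart) =ᶠ[𝓝 x] ψ ∘ π := by
      filter_upwards [chart.open_source.mem_nhds hx] with y hy using (hproj y hy).symm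
    have e4 := hasMFDerivAt_unique e1 (e2.congr_of_eventuallyEq e3)
    exact congrArg (fun T : TangentSpace 𝓘(ℝ, V) x →L[ℝ] W ↦ T ξ) e4
  have hdinj (x) (hx : x ∈ chart.source) : Function.Injective (d x) := hd.mfderiv_injective hx
  let Y (i : Fin k) (p : W × F) : W × F := d (chart.symm p) (X i (chart.symm p))
  have hY (i) (p) (hp : p ∈ chart.target) : ContDiffAt ℝ ω (Y i) p := by
    refine contDiffAt_vectorField_in_chart h1 h2 hp ?_
    exact (hX i).contMDiffAt (hU.mem_nhds (chart.map_target hp).2)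
  let T (p : W × F) : (Fin k → ℝ) →L[ℝ] W × F :=
    ∑ i, ContinuousLinearMap.smulRightL ℝ (Fin k → ℝ) (W × F)
      (ContinuousLinearMap.proj (R := ℝ) (φ := fun _ : Fin k ↦ ℝ) i) (Y i p)
  have hTapp (p c) : T p c = ∑ i, c i • Y i p := by simp [T]
  have hTd (p c) : T p c = d (chart.symm p) (∑ i, c i • X i (chart.symm p)) := by
    rw [hTapp, map_sum]; simp [Y]
  have hT (p) (hp : p ∈ chart.target) : ContDiffAt ℝ ω T p :=
    ContDiffAt.sum fun i _ ↦ (ContinuousLinearMap.contDiff _).contDiffAt.comp p (hY i p hp)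
  let a (p : W × F) : (Fin k → ℝ) →L[ℝ] W := ContinuousLinearMap.fst ℝ W F ∘L T p
  let b (p : W × F) : (Fin k → ℝ) →L[ℝ] F := ContinuousLinearMap.snd ℝ W F ∘L T p
  have hsp (p) (hp : p ∈ chart.target) (ξ : TangentSpace 𝓘(ℝ, V) (chart.symm p)) :
      ξ ∈ D (chart.symm p) ↔ ∃ c : Fin k → ℝ, ∑ i, c i • X i (chart.symm p) = ξ := by
    rw [← (hspan _ (chart.map_target hp).2).2, Submodule.mem_span_range_iff_exists_fun]
  have hainv (p) (hp : p ∈ chart.target) : (a p).IsInvertible := by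
    have hx := chart.map_target hp
    have hcompl := hDπ (chart.symm p)
    have hinj : Function.Injective (a p) := by
      rw [injective_iff_map_eq_zero]
      intro c hc
      set ξ := ∑ i, c i • X i (chart.symm p)
      have h3 : (d (chart.symm p) ξ).1 = 0 := by rw [← hTd]; exact hc
      rw [hdproj _ hx] at h3
      have h4 : mfderiv 𝓘(ℝ, V) 𝓘(ℝ, W) π (chart.symm p) ξ = 0 :=
        hψd.mfderiv_injective (hmaps hx) (h3.trans (map_zero _).symm)
      have h5 : ξ = 0 := (Submodule.disjoint_def.1 hcompl.disjoint) ξ h4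
        ((hsp p hp ξ).2 ⟨c, rfl⟩)
      have h6 := Fintype.linearIndependent_iff.1 (hspan _ hx.2).1 c h5
      exact funext h6
    have hsurj : Function.Surjective (a p) := by
      intro w
      obtain ⟨ξ, hξ⟩ := hd.mfderiv_surjective hx
        (show TangentSpace 𝓘(ℝ, W × F) (chart (chart.symm p)) from ((w, 0) : W × F))
      have hξ' : d (chart.symm p) ξ = (w, 0) := hξ
      obtain ⟨κ, hκ, δ, hδ, hsum⟩ := Submodule.mem_sup.1
        (hcompl.sup_eq_top ▸ Submodule.mem_top : ξ ∈ _ ⊔ _)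
      obtain ⟨c, hc⟩ := (hsp p hp δ).1 hδ
      refine ⟨c, ?_⟩
      change (T p c).1 = w
      rw [hTd, hc]
      have h3 : (d (chart.symm p) κ).1 = 0 := by
        rw [hdproj _ hx, show mfderiv 𝓘(ℝ, V) 𝓘(ℝ, W) π (chart.symm p) κ = 0 from hκ]
        exact map_zero _
      have h4 : d (chart.symm p) κ + d (chart.symm p) δ = (w, 0) := by
        rw [← map_add, hsum, hξ']
      have h5 := congrArg Prod.fst h4
      rwa [Prod.fst_add, h3, zero_add] at h5
    exact ⟨(LinearEquiv.ofBijective (a p : (Fin k → ℝ) →ₗ[ℝ] W)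
      ⟨hinj, hsurj⟩).toContinuousLinearEquiv, rfl⟩
  refine ⟨⟨chart, ψ, fun p ↦ b p ∘L (a p).inverse, h1, h2, contMDiffOn_of_mem_maximalAtlas hψ,
    contMDiffOn_symm_of_mem_maximalAtlas hψ, hmaps, hproj, fun p hp ↦ ?_, fun x hx ξ ↦ ?_⟩,
    h.mem_domChart_source, heU⟩
  · have ha : ContDiffAt ℝ ω a p := contDiffAt_const.clm_comp (hT p hp)
    have hb : ContDiffAt ℝ ω b p := contDiffAt_const.clm_comp (hT p hp)
    exact hb.clm_comp (ContDiffAt.comp p (hainv p hp).contDiffAt_map_inverse ha)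
  · have hp := chart.map_source hx
    obtain ⟨α, hα⟩ := hainv _ hp
    have hslope (c : Fin k → ℝ) : (b (chart x) ∘L (a (chart x)).inverse) (T (chart x) c).1 =
        (T (chart x) c).2 := by
      change b (chart x) ((a (chart x)).inverse (a (chart x) c)) = b (chart x) c
      rw [← hα]; simp
    have hsp' := hsp (chart x) hp
    have hTd' := hTd (chart x)
    rw [chart.left_inv hx] at hsp' hTd'
    rw [hsp']
    change _ ↔ (d x ξ).2 = (b (chart x) ∘L (a (chart x)).inverse) (d x ξ).1
    constructor
    · rintro ⟨c, rfl⟩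
      rw [← hTd', hslope]
    · intro hξ
      refine ⟨(a (chart x)).inverse (d x ξ).1, hdinj x hx ?_⟩
      rw [← hTd']
      have h3 : (T (chart x) ((a (chart x)).inverse (d x ξ).1)).1 = (d x ξ).1 := by
        change a (chart x) ((a (chart x)).inverse (d x ξ).1) = _
        rw [← hα]; simp
      exact Prod.ext h3 (by rw [← hslope, h3, hξ])

end AdaptedChart

/-! ### Horizontal curves and sections in adapted charts -/

namespace AdaptedChart

variable {V W : Type*} [NormedAddCommGroup V] [NormedSpace ℝ V]
  [NormedAddCommGroup W] [NormedSpace ℝ W]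
  {E : Type*} [TopologicalSpace E] [ChartedSpace V E]
  {M : Type*} [TopologicalSpace M] [ChartedSpace W M]
  {F : Type*} [NormedAddCommGroup F] [NormedSpace ℝ F]
  {π : E → M} {D : ∀ x : E, Submodule ℝ (TangentSpace 𝓘(ℝ, V) x)}
  (a : AdaptedChart (W := W) F π D)

lemma mdifferentiable_chart : a.chart.MDifferentiable 𝓘(ℝ, V) 𝓘(ℝ, W × F) :=
  OpenPartialHomeomorph.mdifferentiable_of_contMDiffOn (by simp) a.contMDiffOn_chart
    a.contMDiffOn_chart_symm

lemma mdifferentiable_baseChart : a.baseChart.MDifferentiable 𝓘(ℝ, W) 𝓘(ℝ, W) :=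
  OpenPartialHomeomorph.mdifferentiable_of_contMDiffOn (by simp) a.contMDiffOn_baseChart
    a.contMDiffOn_baseChart_symm

/-- The equation of a horizontal curve in an adapted chart. -/
lemma hasDerivAt_snd_of_horizontal {c : ℝ → E} {t : ℝ}
    (hc : MDifferentiableAt 𝓘(ℝ, ℝ) 𝓘(ℝ, V) c t) (hmem : c t ∈ a.chart.source)
    (hD : mfderiv 𝓘(ℝ, ℝ) 𝓘(ℝ, V) c t (1 : ℝ) ∈ D (c t)) {x' : W}
    (hx : HasDerivAt (fun t ↦ (a.chart (c t)).1) x' t) :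
    HasDerivAt (fun t ↦ (a.chart (c t)).2) (a.slope (a.chart (c t)) x') t := by
  have h0 := (HasMFDerivAt.comp t (a.mdifferentiable_chart.mdifferentiableAt hmem).hasMFDerivAt
    hc.hasMFDerivAt).hasFDerivAt
  set L : ℝ →L[ℝ] W × F := (mfderiv 𝓘(ℝ, V) 𝓘(ℝ, W × F) a.chart (c t)).comp
    (mfderiv 𝓘(ℝ, ℝ) 𝓘(ℝ, V) c t)
  have h1 : HasDerivAt (a.chart ∘ c) (L 1) t := HasFDerivAt.hasDerivAt h0
  have h2 := (a.mem_iff _ hmem _).1 hD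
  have h3 : (mfderiv 𝓘(ℝ, V) 𝓘(ℝ, W × F) a.chart (c t)
      (mfderiv 𝓘(ℝ, ℝ) 𝓘(ℝ, V) c t (1 : ℝ)) : W × F).1 = x' :=
    HasDerivAt.unique (ContinuousLinearMap.fst ℝ W F |>.hasFDerivAt.comp_hasDerivAt t h1) hx
  rw [h3] at h2
  rw [← h2]
  exact ContinuousLinearMap.snd ℝ W F |>.hasFDerivAt.comp_hasDerivAt t h1

/-- The `F`-component of a section of `π` in an adapted chart. -/
def coordSection (s : M → E) (x : W) : F := (a.chart (s (a.baseChart.symm x))).2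

lemma chart_apply_of_isSection {s : M → E} {m : M} (hs : π (s m) = m)
    (hsm : s m ∈ a.chart.source) :
    m ∈ a.baseChart.source ∧ a.chart (s m) = (a.baseChart m, a.coordSection s (a.baseChart m)) := by
  have hm : m ∈ a.baseChart.source := hs ▸ a.mapsTo_source hsm
  refine ⟨hm, Prod.ext ?_ ?_⟩
  · rw [← a.baseChart_apply _ hsm, hs]
  · rw [coordSection, a.baseChart.left_inv hm]

/-- In an adapted chart, a horizontal section is a solution of the Pfaffian system
`dy = slope(x, y) dx`. -/
lemma eventually_hasFDerivAt_coordSection {U : Set M} {s : M → E} {m : M}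
    (hs : IsHorizontalSectionOn (W := W) π D U s) (hU : IsOpen U) (hm : m ∈ U)
    (hsm : s m ∈ a.chart.source) :
    ∀ᶠ x in 𝓝 (a.baseChart m), HasFDerivAt (a.coordSection s)
      (a.slope (x, a.coordSection s x)) x := by
  have hmB := (a.chart_apply_of_isSection (hs.isSection m hm) hsm).1
  have hsc : ContinuousOn s U := hs.smooth.continuousOn
  have hev : ∀ᶠ x in 𝓝 (a.baseChart m), x ∈ a.baseChart.target ∧ a.baseChart.symm x ∈ U ∧
      s (a.baseChart.symm x) ∈ a.chart.source := by
    have h1 := a.baseChart.continuousAt_symm (a.baseChart.map_source hmB)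
    have h2 : ContinuousAt s (a.baseChart.symm (a.baseChart m)) := by
      rw [a.baseChart.left_inv hmB]; exact hsc.continuousAt (hU.mem_nhds hm)
    refine (a.baseChart.open_target.eventually_mem (a.baseChart.map_source hmB)).and
      ((h1.eventually (hU.mem_nhds ?_)).and ((ContinuousAt.comp h2 h1).eventually
        (a.chart.open_source.mem_nhds ?_)))
    · rwa [a.baseChart.left_inv hmB]
    · simpa [a.baseChart.left_inv hmB] using hsm
  have hfst : ∀ᶠ x in 𝓝 (a.baseChart m),
      a.chart (s (a.baseChart.symm x)) = (x, a.coordSection s x) := by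
    filter_upwards [hev] with x hx
    have := (a.chart_apply_of_isSection (hs.isSection _ hx.2.1) hx.2.2).2
    rwa [a.baseChart.right_inv hx.1] at this
  filter_upwards [hev, hfst.eventually_nhds] with x hx hfx
  have hsd : MDifferentiableAt 𝓘(ℝ, W) 𝓘(ℝ, V) s (a.baseChart.symm x) :=
    ((hs.smooth _ hx.2.1).contMDiffAt (hU.mem_nhds hx.2.1)).mdifferentiableAt (by simp)
  have h1 := (HasMFDerivAt.comp x (a.mdifferentiable_chart.mdifferentiableAt hx.2.2).hasMFDerivAt
    (hsd.hasMFDerivAt.comp x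
      (a.mdifferentiable_baseChart.mdifferentiableAt_symm hx.1).hasMFDerivAt)).hasFDerivAt
  set L : W →L[ℝ] W × F := (mfderiv 𝓘(ℝ, V) 𝓘(ℝ, W × F) a.chart (s (a.baseChart.symm x))).comp
    ((mfderiv 𝓘(ℝ, W) 𝓘(ℝ, V) s (a.baseChart.symm x)).comp
      (mfderiv 𝓘(ℝ, W) 𝓘(ℝ, W) a.baseChart.symm x)) with hL
  have hLfst : ContinuousLinearMap.fst ℝ W F ∘L L = .id ℝ W := by
    refine HasFDerivAt.unique ((ContinuousLinearMap.fst ℝ W F).hasFDerivAt.comp x h1)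
      ((hasFDerivAt_id x).congr_of_eventuallyEq ?_)
    filter_upwards [hfx] with z hz
    exact congrArg Prod.fst hz
  have hLsnd : ContinuousLinearMap.snd ℝ W F ∘L L = a.slope (x, a.coordSection s x) := by
    ext w
    have h2 : mfderiv 𝓘(ℝ, W) 𝓘(ℝ, V) s (a.baseChart.symm x)
        (mfderiv 𝓘(ℝ, W) 𝓘(ℝ, W) a.baseChart.symm x w) ∈ D (s (a.baseChart.symm x)) := by
      rw [← hs.horizontal _ hx.2.1]
      exact LinearMap.mem_range_self _ _
    have h3 := (a.mem_iff _ hx.2.2 _).1 h2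
    have h4 : (L w).1 = w := congrArg (fun T : W →L[ℝ] W ↦ T w) hLfst
    change (L w).2 = a.slope _ (L w).1 at h3
    rw [h4, hfx.self_of_nhds] at h3
    exact h3
  rw [← hLsnd]
  exact (ContinuousLinearMap.snd ℝ W F).hasFDerivAt.comp x h1

/-- A solution of the Pfaffian system in an adapted chart is a horizontal section. -/
lemma isHorizontalSectionOn_of_solution {O : Set W} (hO : IsOpen O) {y : W → F}
    (hyt : ∀ x ∈ O, (x, y x) ∈ a.chart.target)
    (hy : ∀ x ∈ O, HasFDerivAt y (a.slope (x, y x)) x) :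
    IsHorizontalSectionOn (W := W) π D (a.baseChart.source ∩ a.baseChart ⁻¹' O)
      (fun m ↦ a.chart.symm (a.baseChart m, y (a.baseChart m))) := by
  set U := a.baseChart.source ∩ a.baseChart ⁻¹' O
  set s : M → E := fun m ↦ a.chart.symm (a.baseChart m, y (a.baseChart m)) with hsdef
  have hU : IsOpen U := a.baseChart.isOpen_inter_preimage hO
  have hysm : ContDiffOn ℝ ∞ y O := contDiffOn_of_solution hO
    (fun x hx ↦ (a.contDiffAt_slope _ (hyt x hx)).of_le le_top) hy
  have hsource : ∀ m ∈ U, s m ∈ a.chart.source := fun m hm ↦ a.chart.map_target (hyt _ hm.2)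
  have hchart : ∀ m ∈ U, a.chart (s m) = (a.baseChart m, y (a.baseChart m)) :=
    fun m hm ↦ a.chart.right_inv (hyt _ hm.2)
  have hsmooth : ContMDiffOn 𝓘(ℝ, W) 𝓘(ℝ, V) ∞ s U := by
    refine (a.contMDiffOn_chart_symm.of_le le_top).comp (t := a.chart.target)
      (f := fun m ↦ (a.baseChart m, y (a.baseChart m))) ?_ fun m hm ↦ hyt _ hm.2
    have h1 : ContMDiffOn 𝓘(ℝ, W) 𝓘(ℝ, W × F) ∞ (fun x ↦ (x, y x)) O :=
      (contDiffOn_id.prodMk hysm).contMDiffOn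
    exact h1.comp ((a.contMDiffOn_baseChart.of_le le_top).mono inter_subset_left)
      fun m hm ↦ hm.2
  refine ⟨hsmooth, fun m hm ↦ ?_, fun m hm ↦ ?_⟩
  · refine a.baseChart.injOn (a.mapsTo_source (hsource m hm)) hm.1 ?_
    rw [a.baseChart_apply _ (hsource m hm), hchart m hm]
  · have hder (w : TangentSpace 𝓘(ℝ, W) m) : (mfderiv 𝓘(ℝ, V) 𝓘(ℝ, W × F) a.chart (s m)
        (mfderiv 𝓘(ℝ, W) 𝓘(ℝ, V) s m w) : W × F) =
        ((mfderiv 𝓘(ℝ, W) 𝓘(ℝ, W) a.baseChart m w : W),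
          a.slope (a.chart (s m)) (mfderiv 𝓘(ℝ, W) 𝓘(ℝ, W) a.baseChart m w)) := by
      have h1 := HasMFDerivAt.comp m
        (a.mdifferentiable_chart.mdifferentiableAt (hsource m hm)).hasMFDerivAt
        (((hsmooth m hm).contMDiffAt (hU.mem_nhds hm)).mdifferentiableAt (by simp)).hasMFDerivAt
      have h2 : HasFDerivAt (fun x ↦ (x, y x))
          ((ContinuousLinearMap.id ℝ W).prod (a.slope (a.baseChart m, y (a.baseChart m))))
          (a.baseChart m) := (hasFDerivAt_id _).prodMk (hy _ hm.2)
      have h3 := HasMFDerivAt.comp m h2.hasMFDerivAt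
        (a.mdifferentiable_baseChart.mdifferentiableAt hm.1).hasMFDerivAt
      have h4 := hasMFDerivAt_unique h1 (h3.congr_of_eventuallyEq
        (Filter.eventually_of_mem (hU.mem_nhds hm) hchart))
      have h5 := congrArg (fun T : TangentSpace 𝓘(ℝ, W) m →L[ℝ] W × F ↦ T w) h4
      rw [hchart m hm]
      exact h5
    have hinj := a.mdifferentiable_chart.mfderiv_injective (hsource m hm)
    ext ξ
    constructor
    · rintro ⟨w, rfl⟩
      refine (a.mem_iff _ (hsource m hm) _).2 ?_
      exact (congrArg Prod.snd (hder w)).trans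
        (congrArg (a.slope (a.chart (s m))) (congrArg Prod.fst (hder w)).symm)
    · intro hξ
      obtain ⟨w, hw⟩ := a.mdifferentiable_baseChart.mfderiv_surjective hm.1
        (show TangentSpace 𝓘(ℝ, W) (a.baseChart m) from
          (mfderiv 𝓘(ℝ, V) 𝓘(ℝ, W × F) a.chart (s m) ξ : W × F).1)
      refine ⟨w, hinj ?_⟩
      refine (hder w).trans ?_
      rw [hw]
      exact Prod.ext rfl ((a.mem_iff _ (hsource m hm) _).1 hξ).symm

end AdaptedChart

/-! ### Lie brackets of horizontal vector fields in adapted charts -/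

namespace AdaptedChart

variable {V W : Type*} [NormedAddCommGroup V] [NormedSpace ℝ V]
  [NormedAddCommGroup W] [NormedSpace ℝ W]
  {E : Type*} [TopologicalSpace E] [ChartedSpace V E]
  {M : Type*} [TopologicalSpace M] [ChartedSpace W M]
  {F : Type*} [NormedAddCommGroup F] [NormedSpace ℝ F]
  {π : E → M} {D : ∀ x : E, Submodule ℝ (TangentSpace 𝓘(ℝ, V) x)}
  (a : AdaptedChart (W := W) F π D)

/-- The vector field on `E` represented by `Z` in the adapted chart `a`. -/
noncomputable def pullback (Z : W × F → W × F) : ∀ x : E, TangentSpace 𝓘(ℝ, V) x :=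
  VectorField.mpullback 𝓘(ℝ, V) 𝓘(ℝ, W × F) a.chart Z

lemma pullback_apply (Z : W × F → W × F) (x : E) :
    a.pullback Z x = (mfderiv 𝓘(ℝ, V) 𝓘(ℝ, W × F) a.chart x).inverse (Z (a.chart x)) := rfl

lemma mfderiv_chart_isInvertible {x : E} (hx : x ∈ a.chart.source) :
    (mfderiv 𝓘(ℝ, V) 𝓘(ℝ, W × F) a.chart x).IsInvertible :=
  ⟨a.mdifferentiable_chart.mfderiv hx, rfl⟩

lemma mfderiv_chart_pullback {x : E} (hx : x ∈ a.chart.source) (Z : W × F → W × F) :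
    (mfderiv 𝓘(ℝ, V) 𝓘(ℝ, W × F) a.chart x (a.pullback Z x) : W × F) = Z (a.chart x) := by
  rw [pullback_apply]
  exact congrArg (fun T : W × F →L[ℝ] W × F ↦ T (Z (a.chart x)))
    (a.mfderiv_chart_isInvertible hx).self_comp_inverse

lemma contMDiffAt_pullback [FiniteDimensional ℝ V] [FiniteDimensional ℝ W]
    [IsManifold 𝓘(ℝ, V) ω E] {x : E} (hx : x ∈ a.chart.source) {Z : W × F → W × F}
    (hZ : ContDiffAt ℝ ω Z (a.chart x)) :
    ContMDiffAt 𝓘(ℝ, V) 𝓘(ℝ, V).tangent ω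
      (fun x ↦ (⟨x, a.pullback Z x⟩ : TangentBundle 𝓘(ℝ, V) E)) x := by
  have : CompleteSpace V := FiniteDimensional.complete ℝ V
  have : CompleteSpace W := FiniteDimensional.complete ℝ W
  have : IsManifold 𝓘(ℝ, V) 1 E := IsManifold.of_le (n := ω) le_top
  exact (contMDiffAt_vectorSpace_iff_contDiffAt.2 hZ).mpullback_vectorField_preimage
    (a.contMDiffOn_chart.contMDiffAt (a.chart.open_source.mem_nhds hx))
    (a.mfderiv_chart_isInvertible hx) (by simp)

lemma mlieBracket_pullback [FiniteDimensional ℝ V] [FiniteDimensional ℝ W] [IsManifold 𝓘(ℝ, V) ω E]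
    [CompleteSpace F] {x : E} (hx : x ∈ a.chart.source) {Z₁ Z₂ : W × F → W × F}
    (hZ₁ : ContDiffAt ℝ ω Z₁ (a.chart x)) (hZ₂ : ContDiffAt ℝ ω Z₂ (a.chart x)) :
    VectorField.mlieBracket 𝓘(ℝ, V) (a.pullback Z₁) (a.pullback Z₂) x =
      a.pullback (VectorField.lieBracket ℝ Z₁ Z₂) x := by
  have : CompleteSpace V := FiniteDimensional.complete ℝ V
  have : CompleteSpace W := FiniteDimensional.complete ℝ W
  have : IsManifold 𝓘(ℝ, V) (minSmoothness ℝ 2) E := IsManifold.of_le (n := ω) le_top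
  have : IsManifold 𝓘(ℝ, V) (minSmoothness ℝ 3) E := IsManifold.of_le (n := ω) le_top
  have h := VectorField.mpullback_mlieBracket (I := 𝓘(ℝ, V)) (I' := 𝓘(ℝ, W × F)) (n := ω)
    (f := a.chart) (x₀ := x) (V := Z₁) (W := Z₂)
    ((contMDiffAt_vectorSpace_iff_contDiffAt.2 hZ₁).mdifferentiableAt (by simp))
    ((contMDiffAt_vectorSpace_iff_contDiffAt.2 hZ₂).mdifferentiableAt (by simp))
    (a.contMDiffOn_chart.contMDiffAt (a.chart.open_source.mem_nhds hx)) le_top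
  have h' : VectorField.mlieBracket 𝓘(ℝ, W × F) Z₁ Z₂ = VectorField.lieBracket ℝ Z₁ Z₂ := by
    have := VectorField.mlieBracketWithin_eq_lieBracketWithin (𝕜 := ℝ) (V := Z₁) (W := Z₂)
      (s := univ)
    rw [VectorField.lieBracketWithin_univ] at this
    exact VectorField.mlieBracketWithin_univ.symm.trans this
  exact h.symm.trans (congrArg (fun Z ↦ a.pullback Z x) h')

/-- The horizontal vector field projecting to the constant vector field `v`, in coordinates. -/
def horizontalField (v : W) (p : W × F) : W × F := (v, a.slope p v)

/-- The local horizontal field over `v` agrees near `e₀` with a global one, by means of a bump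
function. -/
lemma exists_horizontal_eventuallyEq_pullback [FiniteDimensional ℝ V] [FiniteDimensional ℝ W]
    [IsManifold 𝓘(ℝ, V) ω E] [T2Space E] {e₀ : E} (he₀ : e₀ ∈ a.chart.source)
    (v : W) : ∃ X : ∀ x : E, TangentSpace 𝓘(ℝ, V) x, MemGeneratedLieAlgebra D X ∧
      X =ᶠ[𝓝 e₀] a.pullback (a.horizontalField v) := by
  have : IsManifold 𝓘(ℝ, V) ∞ E := IsManifold.of_le (n := ω) le_top
  obtain ⟨ρ, -, hρ⟩ := (SmoothBumpFunction.nhds_basis_tsupport (I := 𝓘(ℝ, V)) e₀).mem_iff.1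
    (a.chart.open_source.mem_nhds he₀)
  refine ⟨fun x ↦ ρ x • a.pullback (a.horizontalField v) x, .horizontal _ ?_ fun x ↦ ?_, ?_⟩
  · refine ContMDiffOn.smul_section_of_tsupport (ρ.contMDiff.contMDiffOn) a.chart.open_source hρ
      fun x hx ↦ ((a.contMDiffAt_pullback hx ?_).of_le le_top).contMDiffWithinAt
    exact contDiffAt_const.prodMk
      ((a.contDiffAt_slope _ (a.chart.map_source hx)).clm_apply contDiffAt_const)
  · by_cases hx : x ∈ a.chart.source
    · refine Submodule.smul_mem _ _ ((a.mem_iff x hx _).2 ?_)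
      rw [a.mfderiv_chart_pullback hx]
      rfl
    · rw [image_eq_zero_of_notMem_tsupport fun h ↦ hx (hρ h), zero_smul]
      exact zero_mem _
  · filter_upwards [ρ.eventuallyEq_one] with x hx
    simp only [hx, Pi.one_apply, one_smul]
    rfl

/-- If the generated Lie algebra is horizontal at `e₀`, then the iterated curvatures vanish there:
each of them is the vertical part of an iterated bracket of horizontal fields, which has no
horizontal part. -/
theorem iteratedCurvature_eq_zero_of_memGeneratedLieAlgebra [FiniteDimensional ℝ V]
    [FiniteDimensional ℝ W] [IsManifold 𝓘(ℝ, V) ω E] [CompleteSpace F] [T2Space E] {e₀ : E}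
    (he₀ : e₀ ∈ a.chart.source)
    (h : ∀ X : ∀ x : E, TangentSpace 𝓘(ℝ, V) x, MemGeneratedLieAlgebra D X → X e₀ ∈ D e₀)
    (v w : W) (k : ℕ) : iteratedCurvature a.slope v w k (a.chart e₀) = 0 := by
  have hsrc : ∀ᶠ x in 𝓝 e₀, x ∈ a.chart.source := a.chart.open_source.mem_nhds he₀
  have hA (x) (hx : x ∈ a.chart.source) := a.contDiffAt_slope _ (a.chart.map_source hx)
  have hd (u : W) (x) (hx : x ∈ a.chart.source) : HasFDerivAt (a.horizontalField u)
      ((0 : W × F →L[ℝ] W).prod ((fderiv ℝ a.slope (a.chart x)).flip u)) (a.chart x) := by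
    refine (hasFDerivAt_const u _).prodMk ?_
    have := ((hA x hx).differentiableAt (by simp)).hasFDerivAt.clm_apply
      (hasFDerivAt_const u (a.chart x))
    simpa using this
  have hs (u : W) (x) (hx : x ∈ a.chart.source) :
      ContDiffAt ℝ ω (a.horizontalField u) (a.chart x) :=
    contDiffAt_const.prodMk ((hA x hx).clm_apply contDiffAt_const)
  obtain ⟨Xv, hXv, hXv'⟩ := a.exists_horizontal_eventuallyEq_pullback he₀ v
  obtain ⟨Xw, hXw, hXw'⟩ := a.exists_horizontal_eventuallyEq_pullback he₀ w
  have key (k : ℕ) : ∃ Z : ∀ x : E, TangentSpace 𝓘(ℝ, V) x, MemGeneratedLieAlgebra D Z ∧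
      Z =ᶠ[𝓝 e₀] a.pullback fun p ↦ (0, iteratedCurvature a.slope v w k p) := by
    induction k with
    | zero =>
      refine ⟨_, .bracket _ _ hXv hXw, (hXv'.mlieBracket_vectorField hXw').trans ?_⟩
      filter_upwards [hsrc] with x hx
      rw [a.mlieBracket_pullback hx (hs v x hx) (hs w x hx)]
      simp only [pullback_apply]
      congr 1
      simp only [VectorField.lieBracket, (hd v x hx).fderiv, (hd w x hx).fderiv]
      simp [horizontalField, iteratedCurvature, pfaffCurvature]
      rfl
    | succ k ih =>
      obtain ⟨Z, hZ, hZ'⟩ := ih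
      refine ⟨_, .bracket _ _ hXv hZ, (hXv'.mlieBracket_vectorField hZ').trans ?_⟩
      filter_upwards [hsrc] with x hx
      have hc := contDiffAt_iteratedCurvature (hA x hx) v w k
      have hcd : HasFDerivAt (fun p ↦ ((0 : W), iteratedCurvature a.slope v w k p)) _ (a.chart x) :=
        (hasFDerivAt_const 0 _).prodMk (hc.differentiableAt (by simp)).hasFDerivAt
      rw [a.mlieBracket_pullback hx (hs v x hx) (contDiffAt_const.prodMk hc)]
      simp only [pullback_apply]
      congr 1
      simp only [VectorField.lieBracket, (hd v x hx).fderiv, hcd.fderiv]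
      simp [horizontalField, iteratedCurvature]
      rfl
  obtain ⟨Z, hZ, hZ'⟩ := key k
  have h1 := (a.mem_iff e₀ he₀ _).1 (h Z hZ)
  rw [hZ'.self_of_nhds, a.mfderiv_chart_pullback he₀] at h1
  simpa using h1

end AdaptedChart

/-! ### Germs of horizontal sections -/

section Germs

variable {V W : Type*} [NormedAddCommGroup V] [NormedSpace ℝ V]
  [NormedAddCommGroup W] [NormedSpace ℝ W]
  {E : Type*} [TopologicalSpace E] [ChartedSpace V E]
  {M : Type*} [TopologicalSpace M] [ChartedSpace W M]
  {F : Type*} [NormedAddCommGroup F] [NormedSpace ℝ F]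
  {π : E → M} {D : ∀ x : E, Submodule ℝ (TangentSpace 𝓘(ℝ, V) x)}

/-- A point `e` of the total space lies on a horizontal section defined near `π e`. -/
def HasHorizontalGerm (W : Type*) [NormedAddCommGroup W] [NormedSpace ℝ W]
    {M : Type*} [TopologicalSpace M] [ChartedSpace W M] (π : E → M)
    (D : ∀ x : E, Submodule ℝ (TangentSpace 𝓘(ℝ, V) x)) (e : E) : Prop :=
  ∃ (U : Set M) (s : M → E), IsOpen U ∧ π e ∈ U ∧ IsHorizontalSectionOn (W := W) π D U s ∧
    s (π e) = e

lemma IsHorizontalSectionOn.hasHorizontalGerm {U : Set M} {s : M → E} {m : M}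
    (hs : IsHorizontalSectionOn (W := W) π D U s) (hU : IsOpen U) (hm : m ∈ U) :
    HasHorizontalGerm W π D (s m) :=
  ⟨U, s, hU, by rwa [hs.isSection m hm], hs, by rw [hs.isSection m hm]⟩

namespace AdaptedChart

lemma eventually_mem_source_of_isHorizontalSectionOn (a : AdaptedChart (W := W) F π D) {U : Set M}
    {s : M → E} {m : M} (hs : IsHorizontalSectionOn (W := W) π D U s) (hU : IsOpen U)
    (hm : m ∈ U) (hsm : s m ∈ a.chart.source) :
    ∀ᶠ m' in 𝓝 m, m' ∈ U ∧ s m' ∈ a.chart.source :=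
  (hU.eventually_mem hm).and ((hs.smooth.continuousOn.continuousAt (hU.mem_nhds hm)).eventually
    (a.chart.open_source.mem_nhds hsm))

/-- Two horizontal sections that agree at a point agree near that point. -/
lemma eventuallyEq_of_isHorizontalSectionOn [CompleteSpace W] [CompleteSpace F]
    (a : AdaptedChart (W := W) F π D)
    {U₁ U₂ : Set M} {s₁ s₂ : M → E} {m : M}
    (h₁ : IsHorizontalSectionOn (W := W) π D U₁ s₁) (hU₁ : IsOpen U₁) (hm₁ : m ∈ U₁)
    (h₂ : IsHorizontalSectionOn (W := W) π D U₂ s₂) (hU₂ : IsOpen U₂) (hm₂ : m ∈ U₂)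
    (hsm : s₁ m ∈ a.chart.source) (heq : s₁ m = s₂ m) : s₁ =ᶠ[𝓝 m] s₂ := by
  have hsm₂ : s₂ m ∈ a.chart.source := heq ▸ hsm
  obtain ⟨hmB, e₁⟩ := a.chart_apply_of_isSection (h₁.isSection m hm₁) hsm
  have e₂ := (a.chart_apply_of_isSection (h₂.isSection m hm₂) hsm₂).2
  have h0 : a.coordSection s₁ (a.baseChart m) = a.coordSection s₂ (a.baseChart m) := by
    have := e₁.symm.trans ((congrArg a.chart heq).trans e₂)
    exact (Prod.ext_iff.1 this).2
  have hA : ContDiffAt ℝ 1 a.slope (a.baseChart m, a.coordSection s₁ (a.baseChart m)) := by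
    rw [← e₁]
    exact (a.contDiffAt_slope _ (a.chart.map_source hsm)).of_le le_top
  have hy := eventuallyEq_of_solutions hA
    (a.eventually_hasFDerivAt_coordSection h₁ hU₁ hm₁ hsm)
    (a.eventually_hasFDerivAt_coordSection h₂ hU₂ hm₂ hsm₂) h0
  filter_upwards [a.eventually_mem_source_of_isHorizontalSectionOn h₁ hU₁ hm₁ hsm,
    a.eventually_mem_source_of_isHorizontalSectionOn h₂ hU₂ hm₂ hsm₂,
    (a.baseChart.continuousAt hmB).eventually hy] with m' hm₁' hm₂' hy'
  refine a.chart.injOn hm₁'.2 hm₂'.2 ?_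
  rw [(a.chart_apply_of_isSection (h₁.isSection m' hm₁'.1) hm₁'.2).2,
    (a.chart_apply_of_isSection (h₂.isSection m' hm₂'.1) hm₂'.2).2, hy']

/-- The obstruction to the existence of a horizontal section through a point is the vanishing of
the iterated curvatures at that point. -/
lemma hasHorizontalGerm_iff [CompleteSpace W] [CompleteSpace F]
    (a : AdaptedChart (W := W) F π D) {e : E}
    (he : e ∈ a.chart.source) :
    HasHorizontalGerm W π D e ↔ ∀ v w k, iteratedCurvature a.slope v w k (a.chart e) = 0 := by
  constructor
  · rintro ⟨U, s, hU, hm, hs, hse⟩ v w k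
    have hsm : s (π e) ∈ a.chart.source := hse.symm ▸ he
    have e₁ := (a.chart_apply_of_isSection (hs.isSection _ hm) hsm).2
    rw [hse] at e₁
    have hy := a.eventually_hasFDerivAt_coordSection hs hU hm hsm
    have hmem : ∀ᶠ x in 𝓝 (a.baseChart (π e)), (x, a.coordSection s x) ∈ a.chart.target := by
      refine (continuousAt_id.prodMk hy.self_of_nhds.continuousAt).eventually
        (a.chart.open_target.mem_nhds ?_)
      simpa only [id, e₁] using a.chart.map_source he
    obtain ⟨O, hO, hOo, hO0⟩ := eventually_nhds_iff.1 (hy.and hmem)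
    rw [e₁]
    exact iteratedCurvature_eq_zero_of_solution hOo
      (fun x hx ↦ a.contDiffAt_slope _ (hO x hx).2) (fun x hx ↦ (hO x hx).1) v w k _ hO0
  · intro h
    have ht := a.chart.map_source he
    obtain ⟨y, hy0, hy⟩ := exists_solution_of_iteratedCurvature_eq_zero (a.contDiffAt_slope _ ht) h
    have hmem : ∀ᶠ x in 𝓝 (a.chart e).1, (x, y x) ∈ a.chart.target := by
      refine (continuousAt_id.prodMk hy.self_of_nhds.continuousAt).eventually
        (a.chart.open_target.mem_nhds ?_)
      simpa only [id, hy0] using ht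
    obtain ⟨O, hO, hOo, hO0⟩ := eventually_nhds_iff.1 (hy.and hmem)
    have hb := a.baseChart_apply e he
    refine ⟨_, _, a.baseChart.isOpen_inter_preimage hOo, ⟨a.mapsTo_source he, ?_⟩,
      a.isHorizontalSectionOn_of_solution hOo (fun x hx ↦ (hO x hx).2) fun x hx ↦ (hO x hx).1, ?_⟩
    · rwa [mem_preimage, hb]
    · simp only [hb, hy0, Prod.mk.eta]
      exact a.chart.left_inv he

end AdaptedChart

/-- The points through which a horizontal section passes form a closed set, since in an adapted
chart they are the common zeros of continuous functions. -/
lemma isClosed_setOf_hasHorizontalGerm [CompleteSpace W] [CompleteSpace F]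
    (hchart : ∀ e : E, ∃ a : AdaptedChart (W := W) F π D, e ∈ a.chart.source) :
    IsClosed {e | HasHorizontalGerm W π D e} := by
  rw [← isOpen_compl_iff, isOpen_iff_mem_nhds]
  intro e he
  obtain ⟨a, ha⟩ := hchart e
  rw [mem_compl_iff, mem_ofPred_eq, a.hasHorizontalGerm_iff ha] at he
  push Not at he
  obtain ⟨v, w, k, hne⟩ := he
  have hc : ContinuousAt (fun x ↦ iteratedCurvature a.slope v w k (a.chart x)) e :=
    ContinuousAt.comp (contDiffAt_iteratedCurvature
      (a.contDiffAt_slope _ (a.chart.map_source ha)) v w k).continuousAt (a.chart.continuousAt ha)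
  filter_upwards [hc.eventually_ne hne, a.chart.open_source.mem_nhds ha] with x hx hxs hg
  exact hx ((a.hasHorizontalGerm_iff hxs).1 hg v w k)

lemma IsPiecewiseSmoothOn.eventually_mdifferentiableAt {c : ℝ → E} {J : Set ℝ}
    (hc : IsPiecewiseSmoothOn (V := V) c J) (hJ : IsOpen J) {t₀ : ℝ} (ht₀ : t₀ ∈ J) :
    ∀ᶠ t in 𝓝[≠] t₀, MDifferentiableAt 𝓘(ℝ, ℝ) 𝓘(ℝ, V) c t := by
  obtain ⟨ε, hε, hεJ⟩ := Metric.nhds_basis_closedBall.mem_iff.1 (hJ.mem_nhds ht₀)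
  rw [Real.closedBall_eq_Icc] at hεJ
  obtain ⟨P, hP⟩ := hc.2 _ _ hεJ
  -- The point `t₀` itself may be a break point, but no other break point is close to it.
  have h1 : ∀ᶠ t in 𝓝[≠] t₀, t ∈ Ioo (t₀ - ε) (t₀ + ε) :=
    nhdsWithin_le_nhds (Ioo_mem_nhds (by linarith) (by linarith))
  have h2 : ∀ᶠ t in 𝓝[≠] t₀, t ∉ P := by
    have h3 : ((P.erase t₀ : Finset ℝ) : Set ℝ)ᶜ ∈ 𝓝 t₀ :=
      (Finset.finite_toSet _).isClosed.isOpen_compl.mem_nhds (by simp)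
    filter_upwards [nhdsWithin_le_nhds h3, self_mem_nhdsWithin] with t ht hne htP
    exact ht (Finset.mem_coe.2 (Finset.mem_erase.2 ⟨hne, htP⟩))
  filter_upwards [h1, h2] with t ht htP
  have h4 : Ioo (t₀ - ε) (t₀ + ε) ∩ (P : Set ℝ)ᶜ ∈ 𝓝 t :=
    Filter.inter_mem (isOpen_Ioo.mem_nhds ht)
      (P.finite_toSet.isClosed.isOpen_compl.mem_nhds htP)
  obtain ⟨δ, hδ, hδP⟩ := Metric.nhds_basis_closedBall.mem_iff.1 h4
  rw [Real.closedBall_eq_Icc] at hδP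
  have h5 := hP (t - δ) (t + δ) (fun r hr ↦ Ioo_subset_Icc_self (hδP hr).1)
    (disjoint_left.2 fun r hr ↦ (hδP (Ioo_subset_Icc_self hr)).2)
  exact (h5.contMDiffAt (Icc_mem_nhds (by linarith) (by linarith))).mdifferentiableAt (by simp)

/-- A horizontal lift of a curve stays on any horizontal section that it meets, near the meeting
point. -/
lemma IsHorizontalLift.eventually_eq_section [CompleteSpace F] (a : AdaptedChart (W := W) F π D)
    {J : Set ℝ} {γ : ℝ → M} {c : ℝ → E} (hc : IsHorizontalLift π D γ J c) (hJ : IsOpen J)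
    (hγ : ContMDiffOn 𝓘(ℝ, ℝ) 𝓘(ℝ, W) ω γ J) {t₀ : ℝ} (ht₀ : t₀ ∈ J) {U : Set M} {s : M → E}
    (hs : IsHorizontalSectionOn (W := W) π D U s) (hU : IsOpen U) (hm : γ t₀ ∈ U)
    (hsc : s (γ t₀) = c t₀) (hsrc : c t₀ ∈ a.chart.source) : ∀ᶠ t in 𝓝 t₀, c t = s (γ t) := by
  have hsm : s (γ t₀) ∈ a.chart.source := hsc.symm ▸ hsrc
  obtain ⟨hmB, e₁⟩ := a.chart_apply_of_isSection (hs.isSection _ hm) hsm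
  have hcc : ContinuousAt c t₀ := hc.piecewiseSmooth.1.continuousAt (hJ.mem_nhds ht₀)
  have hγ₀ := hγ.contMDiffAt (hJ.mem_nhds ht₀)
  have hγc : ContinuousAt γ t₀ := hγ₀.continuousAt
  have hcsrc : ∀ᶠ t in 𝓝 t₀, c t ∈ a.chart.source :=
    hcc.eventually (a.chart.open_source.mem_nhds hsrc)
  have hJt : ∀ᶠ t in 𝓝 t₀, t ∈ J := hJ.mem_nhds ht₀
  have hxsm : ContDiffAt ℝ ω (fun t ↦ a.baseChart (γ t)) t₀ :=
    ((a.contMDiffOn_baseChart.contMDiffAt (a.baseChart.open_source.mem_nhds hmB)).comp t₀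
      hγ₀).contDiffAt
  have hx : ∀ᶠ t in 𝓝 t₀, HasDerivAt (fun t ↦ a.baseChart (γ t))
      (deriv (fun t ↦ a.baseChart (γ t)) t) t := by
    filter_upwards [(hxsm.of_le (m := 1) le_top).eventually (by simp)] with t ht
    exact (ht.differentiableAt (by simp)).hasDerivAt
  have hfst : ∀ᶠ t in 𝓝 t₀, (a.chart (c t)).1 = a.baseChart (γ t) := by
    filter_upwards [hcsrc, hJt] with t ht htJ
    rw [← a.baseChart_apply _ ht, hc.lifts t htJ]
  have hz : ContinuousAt (fun t ↦ (a.chart (c t)).2) t₀ :=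
    continuousAt_snd.comp ((a.chart.continuousAt hsrc).comp hcc)
  have hz0 : (a.chart (c t₀)).2 = a.coordSection s (a.baseChart (γ t₀)) := by
    rw [← hsc, e₁]
  have hz' : ∀ᶠ t in 𝓝[≠] t₀, HasDerivAt (fun t ↦ (a.chart (c t)).2)
      (a.slope (a.baseChart (γ t), (a.chart (c t)).2) (deriv (fun t ↦ a.baseChart (γ t)) t)) t := by
    filter_upwards [hc.piecewiseSmooth.eventually_mdifferentiableAt hJ ht₀,
      nhdsWithin_le_nhds hcsrc, nhdsWithin_le_nhds hJt, nhdsWithin_le_nhds hx,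
      nhdsWithin_le_nhds hfst.eventually_nhds] with t hd hts htJ hxt hft
    have h1 := a.hasDerivAt_snd_of_horizontal hd hts (hc.horizontal t htJ hd)
      (hxt.congr_of_eventuallyEq hft)
    rw [← hft.self_of_nhds]
    exact h1
  have hA : ContDiffAt ℝ 1 a.slope (a.baseChart (γ t₀),
      a.coordSection s (a.baseChart (γ t₀))) := by
    rw [← e₁]
    exact (a.contDiffAt_slope _ (a.chart.map_source hsm)).of_le le_top
  have key := eventually_eq_solution_of_curve (x := fun t ↦ a.baseChart (γ t)) hA
    (a.eventually_hasFDerivAt_coordSection hs hU hm hsm) hx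
    (((hxsm.continuousAt_fderiv (by simp)).clm_apply continuousAt_const)) hz hz0 hz'
  filter_upwards [key, hcsrc, hfst,
    hγc.eventually (a.eventually_mem_source_of_isHorizontalSectionOn hs hU hm hsm)]
    with t ht hts hft hst
  refine a.chart.injOn hts hst.2 ?_
  rw [(a.chart_apply_of_isSection (hs.isSection _ hst.1) hst.2).2]
  exact Prod.ext hft ht

end Germs

/-! ### Local homeomorphisms with local sections through every point -/

section LocalHomeomorph

variable {X Y : Type*} [TopologicalSpace X] [TopologicalSpace Y] {p : X → Y}

lemma IsLocalHomeomorph.isOpen_image_of_isSection (hp : IsLocalHomeomorph p) {B : Set Y}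
    (hB : IsOpen B) {σ : Y → X} (hσ : ContinuousOn σ B) (hpσ : ∀ b ∈ B, p (σ b) = b) :
    IsOpen (σ '' B) := by
  rw [isOpen_iff_mem_nhds]
  rintro _ ⟨b, hb, rfl⟩
  obtain ⟨N, hN, hbN, hinj⟩ := hp.isLocallyInjective (σ b)
  have h1 : Filter.Tendsto (fun e ↦ σ (p e)) (𝓝 (σ b)) (𝓝 (σ b)) := by
    have h2 := hσ.continuousAt (hB.mem_nhds hb)
    have h3 : Filter.Tendsto p (𝓝 (σ b)) (𝓝 b) := by
      simpa only [hpσ b hb] using hp.continuous.tendsto (σ b)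
    exact h2.tendsto.comp h3
  have h4 : ∀ᶠ e in 𝓝 (σ b), p e ∈ B :=
    hp.continuous.continuousAt.eventually (hB.mem_nhds (by rwa [hpσ b hb]))
  filter_upwards [h1 (hN.mem_nhds hbN), hN.mem_nhds hbN, h4] with e h5 h6 h7
  exact ⟨p e, h7, hinj h5 h6 (hpσ _ h7)⟩

/-- A separated local homeomorphism is a covering map if every point of the base has a connected
open neighborhood over which there is a section through each point. -/
theorem IsLocalHomeomorph.isCoveringMap_of_sections (hp : IsLocalHomeomorph p)
    (sep : IsSeparatedMap p)
    (h : ∀ y : Y, ∃ B : Set Y, IsOpen B ∧ IsPreconnected B ∧ y ∈ B ∧ ∀ e, p e ∈ B →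
      ∃ σ : Y → X, ContinuousOn σ B ∧ (∀ b ∈ B, p (σ b) = b) ∧ σ (p e) = e) :
    IsCoveringMap p := by
  intro y
  obtain ⟨B, hB, hBc, hy, hsec⟩ := h y
  rcases isEmpty_or_nonempty (p ⁻¹' {y}) with hemp | hne
  · refine .of_preimage_eq_empty _ (hB.mem_nhds hy) (eq_empty_iff_forall_notMem.2 fun e he ↦ ?_)
    obtain ⟨σ, -, hσ, -⟩ := hsec e he
    exact hemp.elim ⟨σ y, hσ y hy⟩
  · have hfib (i : p ⁻¹' {y}) : p i = y := i.2
    choose σ hσc hpσ hσe using fun i : p ⁻¹' {y} ↦ hsec i (by rw [hfib i]; exact hy)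
    have hσy (i : p ⁻¹' {y}) : σ i y = i := (congrArg (σ i) (hfib i)).symm.trans (hσe i)
    let : TopologicalSpace (p ⁻¹' {y}) := ⊥
    have : DiscreteTopology (p ⁻¹' {y}) := ⟨rfl⟩
    have : Nonempty (Y → X) := ⟨σ hne.some⟩
    have hinj (i) : (σ i '' B).InjOn p := by
      rintro _ ⟨b, hb, rfl⟩ _ ⟨b', hb', rfl⟩ hbb
      rw [hpσ i b hb, hpσ i b' hb'] at hbb
      rw [hbb]
    refine IsEvenlyCovered.to_isEvenlyCovered_preimage (I := p ⁻¹' {y}) <|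
      IsEvenlyCovered.of_trivialization (t := hB.trivializationDiscrete (f := p)
        (fun i ↦ σ i '' B) B (fun i S hS ↦ ⟨fun hSo ↦ ?_, fun hSo ↦ ?_⟩) hinj
        (fun i b hb ↦ ⟨σ i b, mem_image_of_mem _ hb, hpσ i b hb⟩) (fun i j hij ↦ ?_)
        (fun e he ↦ ?_)) hy
    · exact (hSo.preimage hp.continuous).inter (hp.isOpen_image_of_isSection hB (hσc i) (hpσ i))
    · convert hp.isOpenMap _ hSo
      ext b
      constructor
      · exact fun hb ↦ ⟨σ i b, ⟨by rwa [mem_preimage, hpσ i b (hS hb)],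
          mem_image_of_mem _ (hS hb)⟩, hpσ i b (hS hb)⟩
      · rintro ⟨e, he, rfl⟩
        exact he.1
    · refine disjoint_left.2 ?_
      rintro _ ⟨b, hb, rfl⟩ ⟨b', hb', hbb⟩
      have hb2 : b' = b := by rw [← hpσ j b' hb', hbb, hpσ i b hb]
      subst hb2
      have := sep.eqOn_of_comp_eqOn hp.isLocallyInjective hBc (hσc i) (hσc j)
        (fun x hx ↦ by simp only [Function.comp_apply, hpσ i x hx, hpσ j x hx]) hb' hbb.symm hy
      exact hij (Subtype.ext ((hσy i).symm.trans (this.trans (hσy j))))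
    · obtain ⟨τ, hτc, hpτ, hτe⟩ := hsec e he
      refine mem_iUnion.2 ⟨⟨τ y, hpτ y hy⟩, p e, he, ?_⟩
      rw [← hτe, hpτ _ he]
      exact sep.eqOn_of_comp_eqOn hp.isLocallyInjective hBc (hσc _) hτc
        (fun x hx ↦ by simp only [Function.comp_apply, hpσ _ x hx, hpτ x hx]) hy (hσy _) he

end LocalHomeomorph

/-! ### The space of germs of horizontal sections -/

section HorizontalGerms

variable {V W : Type*} [NormedAddCommGroup V] [NormedSpace ℝ V]
  [NormedAddCommGroup W] [NormedSpace ℝ W]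
  {E : Type*} [TopologicalSpace E] [ChartedSpace V E]
  {M : Type*} [TopologicalSpace M] [ChartedSpace W M]
  {F : Type*} [NormedAddCommGroup F] [NormedSpace ℝ F]
  {π : E → M} {D : ∀ x : E, Submodule ℝ (TangentSpace 𝓘(ℝ, V) x)}

/-- The space of germs of horizontal sections. A germ is determined by its value, so that the points
are those of a subset of `E`, but the topology is the finest one for which horizontal sections are
continuous; its connected components are leaves transverse to the fibers of `π`. -/
structure HorizontalGerms (W : Type*) [NormedAddCommGroup W] [NormedSpace ℝ W]
    {M : Type*} [TopologicalSpace M] [ChartedSpace W M] (π : E → M)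
    (D : ∀ x : E, Submodule ℝ (TangentSpace 𝓘(ℝ, V) x)) where
  /-- The value of the germ. -/
  val : E
  hasHorizontalGerm_val : HasHorizontalGerm W π D val

namespace HorizontalGerms

lemma val_injective : Function.Injective (val : HorizontalGerms W π D → E) := by
  rintro ⟨x, hx⟩ ⟨y, hy⟩ (rfl : x = y)
  rfl

/-- The topology coinduced by the horizontal sections: a set is open if its preimage under each of
them is open. -/
instance : TopologicalSpace (HorizontalGerms W π D) where
  IsOpen O := ∀ (U : Set M) (s : M → E), IsOpen U → IsHorizontalSectionOn (W := W) π D U s →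
    IsOpen (U ∩ s ⁻¹' (val '' O))
  isOpen_univ U s hU hs := by
    convert hU
    exact inter_eq_left.2 fun m hm ↦ ⟨⟨s m, hs.hasHorizontalGerm hU hm⟩, mem_univ _, rfl⟩
  isOpen_inter O₁ O₂ h₁ h₂ U s hU hs := by
    rw [image_inter val_injective, preimage_inter, inter_inter_distrib_left]
    exact (h₁ U s hU hs).inter (h₂ U s hU hs)
  isOpen_sUnion S h U s hU hs := by
    rw [sUnion_eq_biUnion, image_iUnion₂, preimage_iUnion₂, inter_iUnion₂]
    exact isOpen_biUnion fun O hO ↦ h O hO U s hU hs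

lemma isOpen_iff {O : Set (HorizontalGerms W π D)} : IsOpen O ↔
    ∀ (U : Set M) (s : M → E), IsOpen U → IsHorizontalSectionOn (W := W) π D U s →
      IsOpen (U ∩ s ⁻¹' (val '' O)) := Iff.rfl

/-- The projection of the space of germs to the base. -/
def proj (e : HorizontalGerms W π D) : M := π e.val

lemma continuous_val : Continuous (val : HorizontalGerms W π D → E) := by
  refine continuous_def.2 fun G hG ↦ isOpen_iff.2 fun U s hU hs ↦ ?_
  convert hs.smooth.continuousOn.isOpen_inter_preimage hU hG using 1
  ext m
  refine and_congr_right fun hm ↦ ⟨?_, fun h ↦ ⟨⟨s m, hs.hasHorizontalGerm hU hm⟩, h, rfl⟩⟩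
  rintro ⟨e, he, hes⟩
  rw [mem_preimage, ← hes]
  exact he

lemma continuous_proj : Continuous (proj : HorizontalGerms W π D → M) := by
  refine continuous_def.2 fun G hG ↦ isOpen_iff.2 fun U s hU hs ↦ ?_
  convert hU.inter hG using 1
  ext m
  refine and_congr_right fun hm ↦ ⟨?_, fun h ↦ ⟨⟨s m, hs.hasHorizontalGerm hU hm⟩, ?_, rfl⟩⟩
  · rintro ⟨e, he, hes⟩
    rw [← hs.isSection m hm, ← hes]
    exact he
  · rw [mem_preimage, proj, hs.isSection m hm]
    exact h

lemma isSeparatedMap_proj [T2Space E] :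
    IsSeparatedMap (proj : HorizontalGerms W π D → M) := by
  intro e₁ e₂ _ hne
  obtain ⟨u, v, hu, hv, h₁, h₂, huv⟩ := t2_separation (val_injective.ne hne)
  exact ⟨_, _, hu.preimage continuous_val, hv.preimage continuous_val, h₁, h₂, huv.preimage _⟩

/-- A map to the space of germs which locally follows a horizontal section is continuous. -/
lemma continuousAt_of_eventuallyEq_section {T : Type*} [TopologicalSpace T]
    {g : T → HorizontalGerms W π D} {f : T → M} {t : T} {U : Set M} {s : M → E}
    (hs : IsHorizontalSectionOn (W := W) π D U s) (hU : IsOpen U) (hf : ContinuousAt f t)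
    (hft : f t ∈ U) (h : ∀ᶠ t' in 𝓝 t, (g t').val = s (f t')) : ContinuousAt g t := by
  refine Filter.tendsto_def.2 fun N hN ↦ ?_
  obtain ⟨O, hON, hO, ht⟩ := mem_nhds_iff.1 hN
  have h1 : ∀ᶠ t' in 𝓝 t, f t' ∈ U ∩ s ⁻¹' (val '' O) :=
    hf.eventually ((isOpen_iff.1 hO U s hU hs).mem_nhds
      ⟨hft, g t, ht, h.self_of_nhds⟩)
  filter_upwards [h, h1] with t' h2 h3
  obtain ⟨n, hn, hns⟩ := h3.2
  rw [mem_preimage, val_injective (h2.trans hns.symm)]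
  exact hON hn

/-- The image of a horizontal section is open: this is the local uniqueness of horizontal
sections. -/
lemma isOpen_setOf_val_eq [CompleteSpace W] [CompleteSpace F]
    (hchart : ∀ e : E, ∃ a : AdaptedChart (W := W) F π D, e ∈ a.chart.source)
    {U : Set M} {s : M → E} (hs : IsHorizontalSectionOn (W := W) π D U s) (hU : IsOpen U) :
    IsOpen {e : HorizontalGerms W π D | proj e ∈ U ∧ e.val = s (proj e)} := by
  refine isOpen_iff.2 fun U' s' hU' hs' ↦ isOpen_iff_mem_nhds.2 ?_
  rintro m ⟨hm, e, ⟨he, hes⟩, hem⟩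
  have hpe : proj e = m := by rw [proj, hem, hs'.isSection m hm]
  rw [hpe] at he hes
  obtain ⟨a, ha⟩ := hchart (s m)
  have heq := a.eventuallyEq_of_isHorizontalSectionOn hs hU he hs' hU' hm ha (hes.symm.trans hem)
  filter_upwards [heq, hU'.mem_nhds hm, hU.mem_nhds he] with m' h1 h2 h3
  refine ⟨h2, ⟨s' m', hs'.hasHorizontalGerm hU' h2⟩, ?_, rfl⟩
  have h4 : π (s' m') = m' := hs'.isSection m' h2
  simp only [mem_ofPred_eq, proj, h4]
  exact ⟨h3, h1.symm⟩

lemma isLocalHomeomorph_proj [CompleteSpace W] [CompleteSpace F]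
    (hchart : ∀ e : E, ∃ a : AdaptedChart (W := W) F π D, e ∈ a.chart.source) :
    IsLocalHomeomorph (proj : HorizontalGerms W π D → M) := by
  refine isLocalHomeomorph_iff_isOpenEmbedding_restrict.2 fun e ↦ ?_
  obtain ⟨U, s, hU, he, hs, hse⟩ := e.hasHorizontalGerm_val
  have hO := isOpen_setOf_val_eq hchart hs hU
  refine ⟨_, hO.mem_nhds ⟨he, hse.symm⟩, .of_continuous_injective_isOpenMap
    continuous_proj.continuousOn.domRestrict ?_ ?_⟩
  · rintro ⟨e₁, h₁⟩ ⟨e₂, h₂⟩ h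
    refine Subtype.ext (val_injective ?_)
    rw [h₁.2, h₂.2]
    exact congrArg s h
  · intro G hG
    obtain ⟨G', hG', rfl⟩ := isOpen_induced_iff.1 hG
    convert isOpen_iff.1 hG' U s hU hs
    ext m
    constructor
    · rintro ⟨⟨e', h'⟩, hG, rfl⟩
      exact ⟨h'.1, e', hG, h'.2⟩
    · rintro ⟨hm, e', hG, hes⟩
      have hpe : proj e' = m := by rw [proj, hes, hs.isSection m hm]
      exact ⟨⟨e', by rwa [hpe], by rw [hpe, hes]⟩, hG, hpe⟩

open Classical in
/-- The germ with value `x` if there is one, and the junk value `e` otherwise. -/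
noncomputable def ofVal (e : HorizontalGerms W π D) (x : E) : HorizontalGerms W π D :=
  if h : HasHorizontalGerm W π D x then ⟨x, h⟩ else e

lemma val_ofVal (e : HorizontalGerms W π D) {x : E} (h : HasHorizontalGerm W π D x) :
    (ofVal e x).val = x := by
  rw [ofVal, dif_pos h]

/-- If analytic curves lift horizontally, then they lift to the space of germs: since the points on
horizontal sections form a closed set, a horizontal lift cannot leave it. -/
lemma exists_continuousOn_lift [CompleteSpace W] [CompleteSpace F]
    (hchart : ∀ e : E, ∃ a : AdaptedChart (W := W) F π D, e ∈ a.chart.source)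
    {J : Set ℝ} {γ : ℝ → M} {c : ℝ → E} (hc : IsHorizontalLift π D γ J c) (hJ : IsOpen J)
    (hJc : J.OrdConnected) (hγ : ContMDiffOn 𝓘(ℝ, ℝ) 𝓘(ℝ, W) ω γ J) {t₀ : ℝ} (ht₀ : t₀ ∈ J)
    (e : HorizontalGerms W π D) (he : c t₀ = e.val) :
    ∃ g : ℝ → HorizontalGerms W π D, ContinuousOn g J ∧ (∀ t ∈ J, proj (g t) = γ t) ∧ g t₀ = e := by
  have hsec {t : ℝ} (ht : t ∈ J) (hg : HasHorizontalGerm W π D (c t)) :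
      ∃ (U : Set M) (s : M → E), IsOpen U ∧ γ t ∈ U ∧ IsHorizontalSectionOn (W := W) π D U s ∧
        ∀ᶠ t' in 𝓝 t, c t' = s (γ t') := by
    obtain ⟨U, s, hU, hm, hs, hse⟩ := hg
    rw [hc.lifts t ht] at hm hse
    obtain ⟨a, ha⟩ := hchart (c t)
    exact ⟨U, s, hU, hm, hs, hc.eventually_eq_section a hJ hγ ht hs hU hm hse ha⟩
  have hγc {t : ℝ} (ht : t ∈ J) : ContinuousAt γ t := hγ.continuousOn.continuousAt (hJ.mem_nhds ht)
  have hgerm : ∀ t ∈ J, HasHorizontalGerm W π D (c t) := by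
    -- The set of times at which the lift is on a section is open, and closed in `J`.
    have hopen : IsOpen {t | t ∈ J ∧ HasHorizontalGerm W π D (c t)} := by
      refine isOpen_iff_mem_nhds.2 fun t ht ↦ ?_
      obtain ⟨U, s, hU, hm, hs, hev⟩ := hsec ht.1 ht.2
      filter_upwards [hev, (hγc ht.1).eventually (hU.mem_nhds hm),
        hJ.mem_nhds ht.1] with t' h1 h2 h3
      exact ⟨h3, h1 ▸ hs.hasHorizontalGerm hU h2⟩
    have hsub := hJc.isPreconnected.subset_of_closure_inter_subset hopen
      ⟨t₀, ht₀, ht₀, he ▸ e.hasHorizontalGerm_val⟩ ?_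
    · exact fun t ht ↦ (hsub ht).2
    · rintro t ⟨htc, ht⟩
      have h1 := (hc.piecewiseSmooth.1.continuousAt
        (hJ.mem_nhds ht)).continuousWithinAt.mem_closure_image htc
      refine ⟨ht, closure_minimal ?_ (isClosed_setOf_hasHorizontalGerm hchart) h1⟩
      rintro _ ⟨t', ht', rfl⟩
      exact ht'.2
  refine ⟨fun t ↦ ofVal e (c t), fun t ht ↦ ?_, fun t ht ↦ ?_, val_injective ?_⟩
  · obtain ⟨U, s, hU, hm, hs, hev⟩ := hsec ht (hgerm t ht)
    refine (continuousAt_of_eventuallyEq_section hs hU (hγc ht) hm ?_).continuousWithinAt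
    filter_upwards [hev, hJ.mem_nhds ht] with t' h1 h2
    rw [val_ofVal e (hgerm t' h2), h1]
  · rw [proj, val_ofVal e (hgerm t ht), hc.lifts t ht]
  · rw [val_ofVal e (hgerm t₀ ht₀), he]

end HorizontalGerms

end HorizontalGerms

/-! ### Global horizontal sections -/

section GlobalSection

variable {V W : Type*} [NormedAddCommGroup V] [NormedSpace ℝ V]
  [NormedAddCommGroup W] [NormedSpace ℝ W] [CompleteSpace W]
  {E : Type*} [TopologicalSpace E] [ChartedSpace V E]
  {M : Type*} [TopologicalSpace M] [ChartedSpace W M]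
  {F : Type*} [NormedAddCommGroup F] [NormedSpace ℝ F] [CompleteSpace F]
  {π : E → M} {D : ∀ x : E, Submodule ℝ (TangentSpace 𝓘(ℝ, V) x)}

namespace HorizontalGerms

/-- Over a coordinate ball there is a section of the space of germs through each point, obtained by
lifting the segments that start at its base point. -/
lemma exists_section_of_ball [T2Space E]
    (hchart : ∀ e : E, ∃ a : AdaptedChart (W := W) F π D, e ∈ a.chart.source)
    (hlift : ∀ (J : Set ℝ) (γ : ℝ → M), IsOpen J → J.OrdConnected →
      ContMDiffOn 𝓘(ℝ, ℝ) 𝓘(ℝ, W) ω γ J →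
      ∀ t₀ ∈ J, ∀ e₀ : E, π e₀ = γ t₀ → ∃ c : ℝ → E, IsHorizontalLift π D γ J c ∧ c t₀ = e₀)
    {ψ : OpenPartialHomeomorph M W} (hψ : ContMDiffOn 𝓘(ℝ, W) 𝓘(ℝ, W) ω ψ.symm ψ.target)
    {x : W} {r : ℝ} (hr : Metric.ball x r ⊆ ψ.target) (e : HorizontalGerms W π D)
    (he : proj e ∈ ψ.symm '' Metric.ball x r) :
    ∃ σ : M → HorizontalGerms W π D, ContinuousOn σ (ψ.symm '' Metric.ball x r) ∧
      (∀ m ∈ ψ.symm '' Metric.ball x r, proj (σ m) = m) ∧ σ (proj e) = e := by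
  obtain ⟨b, hb, hbe⟩ := he
  let line (q : W) (t : ℝ) : W := b + t • (q - b)
  have hline (q : W) : ContDiff ℝ ω (line q) := contDiff_const.add (contDiff_id.smul contDiff_const)
  have hline0 (q : W) : line q 0 = b := by simp [line]
  have hline1 (q : W) : line q 1 = q := by simp [line]
  let J (q : W) : Set ℝ := line q ⁻¹' Metric.ball x r
  have hJ (q : W) : IsOpen (J q) := Metric.isOpen_ball.preimage (hline q).continuous
  have hJc (q : W) : (J q).OrdConnected := by
    have : line q = AffineMap.lineMap b q := by
      ext t
      simp [line, AffineMap.lineMap_apply, add_comm]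
    have h2 : Convex ℝ (J q) := by
      simp only [J, this]
      exact (convex_ball x r).affine_preimage _
    exact h2.ordConnected
  have h0 (q : W) : (0 : ℝ) ∈ J q := by simpa [J, hline0] using hb
  have h1 {q : W} (hq : q ∈ Metric.ball x r) : (1 : ℝ) ∈ J q := by simpa [J, hline1] using hq
  have hex (q : W) : ∃ g : ℝ → HorizontalGerms W π D, ContinuousOn g (J q) ∧
      (∀ t ∈ J q, proj (g t) = ψ.symm (line q t)) ∧ g 0 = e := by
    have hγ : ContMDiffOn 𝓘(ℝ, ℝ) 𝓘(ℝ, W) ω (fun t ↦ ψ.symm (line q t)) (J q) :=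
      hψ.comp (hline q).contMDiff.contMDiffOn fun t ht ↦ hr ht
    obtain ⟨c, hc, hc0⟩ := hlift (J q) _ (hJ q) (hJc q) hγ 0 (h0 q) e.val
      (by rw [hline0, hbe]; rfl)
    exact exists_continuousOn_lift hchart hc (hJ q) (hJc q) hγ (h0 q) e hc0
  choose g hgc hgp hg0 using hex
  have hmem (t : unitInterval) (q : Metric.ball x r) : (t : ℝ) ∈ J q :=
    (hJc q).out (h0 q) (h1 q.2) t.2
  have hcont : Continuous fun z : unitInterval × Metric.ball x r ↦ g z.2 z.1 := by
    let f : C(unitInterval × Metric.ball x r, M) :=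
      ⟨fun z ↦ ψ.symm (line z.2 z.1), ψ.continuousOn_symm.comp_continuous
        (by fun_prop) fun z ↦ hr (hmem z.1 z.2)⟩
    refine (isLocalHomeomorph_proj hchart).continuous_lift isSeparatedMap_proj f
      (funext fun z ↦ hgp _ _ (hmem z.1 z.2)) ?_ fun q ↦ ?_
    · simpa [hg0] using continuous_const
    · exact (hgc q).comp_continuous continuous_subtype_val fun t ↦ hmem t q
  have hsymm (q : W) (hq : q ∈ Metric.ball x r) : ψ (ψ.symm q) = q := ψ.right_inv (hr hq)
  refine ⟨fun m ↦ g (ψ m) 1, ?_, ?_, ?_⟩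
  · rw [continuousOn_iff_continuous_domRestrict]
    have hψc : Continuous fun m : ψ.symm '' Metric.ball x r ↦
        (⟨ψ m, by obtain ⟨_, q, hq, rfl⟩ := m; rwa [hsymm q hq]⟩ : Metric.ball x r) := by
      refine Continuous.subtype_mk (ψ.continuousOn.comp_continuous continuous_subtype_val ?_) _
      rintro ⟨_, q, hq, rfl⟩
      exact ψ.map_target (hr hq)
    exact hcont.comp (continuous_const (y := (1 : unitInterval)) |>.prodMk hψc)
  · rintro _ ⟨q, hq, rfl⟩
    simp only [hsymm q hq, hgp q 1 (h1 hq), hline1]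
  · have hbb : line b = fun _ ↦ b := by ext t; simp [line]
    -- The lift of the constant segment is constant.
    simp only [← hbe, hsymm b hb]
    rw [← hg0 b]
    refine isSeparatedMap_proj.eqOn_of_comp_eqOn (g₁ := g b) (g₂ := fun _ ↦ g b 0)
      (isLocalHomeomorph_proj hchart).isLocallyInjective (s := J b) (hJc b).isPreconnected (hgc b)
      continuousOn_const (fun t ht ↦ ?_) (h0 b) rfl (h1 hb)
    simp only [Function.comp_apply, hgp b t ht, hgp b 0 (h0 b), hbb]

/-- If analytic curves lift horizontally, the space of germs of horizontal sections is a covering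
space of the base. -/
theorem isCoveringMap_proj [T2Space E] [IsManifold 𝓘(ℝ, W) ω M]
    (hchart : ∀ e : E, ∃ a : AdaptedChart (W := W) F π D, e ∈ a.chart.source)
    (hlift : ∀ (J : Set ℝ) (γ : ℝ → M), IsOpen J → J.OrdConnected →
      ContMDiffOn 𝓘(ℝ, ℝ) 𝓘(ℝ, W) ω γ J →
      ∀ t₀ ∈ J, ∀ e₀ : E, π e₀ = γ t₀ → ∃ c : ℝ → E, IsHorizontalLift π D γ J c ∧ c t₀ = e₀) :
    IsCoveringMap (proj : HorizontalGerms W π D → M) := by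
  refine (isLocalHomeomorph_proj hchart).isCoveringMap_of_sections isSeparatedMap_proj fun m ↦ ?_
  set ψ := chartAt W m
  have hm : ψ m ∈ ψ.target := ψ.map_source (mem_chart_source W m)
  obtain ⟨r, hr, hrt⟩ := Metric.isOpen_iff.1 ψ.open_target _ hm
  refine ⟨ψ.symm '' Metric.ball (ψ m) r, ?_, ?_, ⟨ψ m, Metric.mem_ball_self hr,
    ψ.left_inv (mem_chart_source W m)⟩, fun e he ↦ ?_⟩
  · exact ψ.symm.isOpen_image_of_subset_source Metric.isOpen_ball hrt
  · exact (convex_ball _ r).isPreconnected.image _ (ψ.continuousOn_symm.mono hrt)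
  · exact exists_section_of_ball hchart hlift contMDiffOn_chart_symm hrt e he

/-- A continuous section of the space of germs is a horizontal section. -/
lemma isHorizontalSectionOn_val
    (hchart : ∀ e : E, ∃ a : AdaptedChart (W := W) F π D, e ∈ a.chart.source)
    {G : M → HorizontalGerms W π D} (hG : Continuous G) (hpG : ∀ m, proj (G m) = m) :
    IsHorizontalSectionOn (W := W) π D univ fun m ↦ (G m).val := by
  have hsec (m : M) : ∃ (U : Set M) (s : M → E), IsOpen U ∧ m ∈ U ∧
      IsHorizontalSectionOn (W := W) π D U s ∧ (fun m ↦ (G m).val) =ᶠ[𝓝 m] s := by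
    obtain ⟨U, s, hU, hm, hs, hse⟩ := (G m).hasHorizontalGerm_val
    have hO := (isOpen_setOf_val_eq hchart hs hU).preimage hG
    have hpm : π (G m).val = m := hpG m
    refine ⟨U, s, hU, hpm ▸ hm, hs, ?_⟩
    filter_upwards [hO.mem_nhds (x := m) ⟨hm, hse.symm⟩] with m' hm'
    exact hm'.2.trans (congrArg s (hpG m'))
  refine ⟨fun m _ ↦ ?_, fun m _ ↦ hpG m, fun m _ ↦ ?_⟩ <;>
    obtain ⟨U, s, hU, hm, hs, heq⟩ := hsec m
  · exact (((hs.smooth m hm).contMDiffAt (hU.mem_nhds hm)).congr_of_eventuallyEq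
      heq).contMDiffWithinAt
  · let D' : E → Submodule ℝ V := D
    have h1 : D' (s m) = D' (G m).val := congrArg D' heq.self_of_nhds.symm
    rw [heq.mfderiv_eq]
    exact (hs.horizontal m hm).trans h1

/-- Over a simply connected base, every germ of a horizontal section extends to a global horizontal
section, which agrees with every horizontal section on a connected open set that represents the
germ. -/
theorem exists_global_section [T2Space E] [SimplyConnectedSpace M] [IsManifold 𝓘(ℝ, W) ω M]
    (hchart : ∀ e : E, ∃ a : AdaptedChart (W := W) F π D, e ∈ a.chart.source)
    (hlift : ∀ (J : Set ℝ) (γ : ℝ → M), IsOpen J → J.OrdConnected →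
      ContMDiffOn 𝓘(ℝ, ℝ) 𝓘(ℝ, W) ω γ J →
      ∀ t₀ ∈ J, ∀ e₀ : E, π e₀ = γ t₀ → ∃ c : ℝ → E, IsHorizontalLift π D γ J c ∧ c t₀ = e₀)
    (e : HorizontalGerms W π D) :
    ∃ S : M → E, IsHorizontalSectionOn (W := W) π D univ S ∧
      ∀ (U : Set M) (s : M → E), IsOpen U → IsPreconnected U →
        IsHorizontalSectionOn (W := W) π D U s → proj e ∈ U → s (proj e) = e.val → EqOn S s U := by
  have : LocallyPathConnectedSpace M := ChartedSpace.locallyPathConnectedSpace W M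
  have hcov := isCoveringMap_proj hchart hlift
  obtain ⟨G, ⟨hGe, hpG⟩, -⟩ := hcov.existsUnique_continuousMap_lifts (.id M) (proj e) e rfl
  have hpG' (m : M) : proj (G m) = m := congrFun hpG m
  refine ⟨fun m ↦ (G m).val, isHorizontalSectionOn_val hchart G.continuous hpG', ?_⟩
  intro U s hU hUc hs he hse
  have hgerm (m : M) (hm : m ∈ U) := val_ofVal e (hs.hasHorizontalGerm hU hm)
  have hc : ContinuousOn (fun m ↦ ofVal e (s m)) U := fun m hm ↦
    (continuousAt_of_eventuallyEq_section hs hU continuousAt_id hm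
      (Filter.eventually_of_mem (hU.mem_nhds hm) hgerm)).continuousWithinAt
  have heq := isSeparatedMap_proj.eqOn_of_comp_eqOn hcov.isLocalHomeomorph.isLocallyInjective hUc
    G.continuous.continuousOn hc (fun m hm ↦ ?_) he ?_
  · exact fun m hm ↦ (congrArg val (heq hm)).trans (hgerm m hm)
  · exact (hpG' m).trans ((hs.isSection m hm).symm.trans (congrArg π (hgerm m hm).symm))
  · exact val_injective (by rw [hGe, hgerm _ he, hse])

end HorizontalGerms

end GlobalSection

theorem proposition3p12
    {V W : Type*} [NormedAddCommGroup V] [NormedSpace ℝ V] [FiniteDimensional ℝ V]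
    [NormedAddCommGroup W] [NormedSpace ℝ W] [FiniteDimensional ℝ W]
    {E : Type*} [TopologicalSpace E] [T2Space E] [ChartedSpace V E] [IsManifold 𝓘(ℝ, V) ω E]
    {M : Type*} [TopologicalSpace M] [T2Space M] [ChartedSpace W M] [IsManifold 𝓘(ℝ, W) ω M]
    (π : E → M) (hπ : IsSubmersion 𝓘(ℝ, V) 𝓘(ℝ, W) ω π)
    (D : ∀ x : E, Submodule ℝ (TangentSpace 𝓘(ℝ, V) x))
    (hD : IsAnalyticDistribution D)
    (hDπ : IsHorizontalDistribution (W := W) π D)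
    (hM : SimplyConnectedSpace M)
    (hlift : ∀ (J : Set ℝ) (γ : ℝ → M), IsOpen J → J.OrdConnected →
      ContMDiffOn 𝓘(ℝ, ℝ) 𝓘(ℝ, W) ω γ J →
      ∀ t₀ ∈ J, ∀ e₀ : E, π e₀ = γ t₀ →
        ∃ c : ℝ → E, IsHorizontalLift π D γ J c ∧ c t₀ = e₀) :
    (∀ (U : Set M) (s : M → E), IsOpen U → IsConnected U →
      IsHorizontalSectionOn (W := W) π D U s →
      ∃ S : M → E, IsHorizontalSectionOn (W := W) π D univ S ∧ EqOn S s U) ∧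
    (∀ e₀ : E, (∀ X : (∀ x : E, TangentSpace 𝓘(ℝ, V) x),
        MemGeneratedLieAlgebra D X → X e₀ ∈ D e₀) →
      ∃ S : M → E, IsHorizontalSectionOn (W := W) π D univ S) := by
  have : CompleteSpace W := FiniteDimensional.complete ℝ W
  have hcomplete (e : E) : CompleteSpace hπ.complement := by
    have : FiniteDimensional ℝ (W × hπ.complement) :=
      (hπ.isSubmersionOfComplement_complement e).equiv.toLinearEquiv.finiteDimensional
    have : FiniteDimensional ℝ hπ.complement :=
      .of_surjective (LinearMap.snd ℝ W hπ.complement) LinearMap.snd_surjective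
    exact FiniteDimensional.complete ℝ hπ.complement
  have hchart (e : E) : ∃ a : AdaptedChart (W := W) hπ.complement π D, e ∈ a.chart.source :=
    have := hcomplete e
    exists_adaptedChart hD hDπ (hπ.isSubmersionOfComplement_complement e) hπ.contMDiff
  constructor
  · intro U s hU hUc hs
    obtain ⟨m, hm⟩ := hUc.nonempty
    have := hcomplete (s m)
    obtain ⟨S, hS, hSU⟩ := HorizontalGerms.exists_global_section hchart hlift
      ⟨s m, hs.hasHorizontalGerm hU hm⟩
    have hp : π (s m) = m := hs.isSection m hm
    exact ⟨S, hS, hSU U s hU hUc.isPreconnected hs (by rwa [HorizontalGerms.proj, hp])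
      (by rw [HorizontalGerms.proj, hp])⟩
  · intro e₀ he₀
    have := hcomplete e₀
    obtain ⟨a, ha⟩ := hchart e₀
    obtain ⟨S, hS, -⟩ := HorizontalGerms.exists_global_section hchart hlift ⟨e₀,
      (a.hasHorizontalGerm_iff ha).2 (a.iteratedCurvature_eq_zero_of_memGeneratedLieAlgebra ha he₀)⟩
    exact ⟨S, hS⟩
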